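/- Let $p,q\in(1,\infty)$ with $1/p+1/q=1$. Let $\Omega\subset\mathbb R^d$ be a bounded open convex set and $\Lambda\subset\mathbb R^d$ a convex set with $B(0,1/r^*)\subset\Lambda\subset B(0,r^*/2)$ for some $r^*>1$, and assume $\mathcal L^d(\Omega)=\mathcal L^d(\Lambda)$. Assume that $\partial\Omega$ is smooth and coincides with the set of extreme points of $\overline\Omega$. Let $\mathcal S$ be a non-empty, closed, convex subset of $W^{1,q}_0(\Omega,\mathbb R^{d\times d})$ whose linear span is finite dimensional. Let $f:\mathbb R^{d\times d}\to\mathbb R$ be convex, with Legendre transform $f^*(\eta)=\sup_\xi\{\xi\cdot\eta-f(\xi)\}\in(-\infty,\infty]$, and assume: (i) there are $a,b,c>0$ such that $a|\xi|-b\le f(\xi)\le c\frac{|\xi|^p}{p}+b$ for all $\xi$, and $|\eta|^q\le c|\xi|^p+b$ for all $\xi$ and all $\eta\in\partial f(\xi)$; (ii) there is $\varphi\in\mathcal S$ for which $\int_\Omega f^*(\varphi)\,dx$ is finite; (iii) either $f$ is strictly convex, or for every $\eta$ with $f^*(\eta)<\infty$ the subdifferential $\partial f^*(\eta)$ is non-empty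 and its element of minimal norm is $0$. A map $g:\Omega\to\mathbb R^d$ is called non-degenerate if $\mathcal L^d(g^{-1}(N))=0$ for every $N\subset\mathbb R^d$ with $\mathcal L^d(N)=0$. With $(\operatorname{div}\varphi)_i=\sum_j\partial_j\varphi_{ij}$, assume that $\operatorname{div}\varphi$ is non-degenerate for every $\varphi\in\mathcal S$. Let $F\in L^1(\Omega,\mathbb R^d)$ have countable range. Then: 1. $F+\operatorname{div}\varphi$ is non-degenerate for every $\varphi\in\mathcal S$, that is, $F$ satisfies the condition $(\mathrm{ND})_{\mathcal S}$. 2. The problem $$\inf_{u\in\mathscr U^1_{\mathcal S}}\Big\{V^f_{\mathcal S}(u)-\int_\Omega F\cdot u\,dx\Big\},\qquad V^f_{\mathcal S}(u)=\sup_{\varphi\in\mathcal S}\int_\Omega\big(-u\cdot\operatorname{div}\varphi-f^*(\varphi)\big)\,dx,$$ has a minimizer, and it is unique up to equality almost everywhere in $\Omega$. Here $\mathscr U^1_{\mathcal S}$ is the set of measurable $u:\Omega\to\overline\Lambda$ such that there is a constant $\bar c>0$ (depending on $u$) with $\big|\int_\Omega u\cdot\operatorname{div}\varphi\,dx\big|\le\bar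 c\,\|\varphi\|_{L^q(\Omega)}$ for all $\varphi\in\mathcal S$, and such that $\int_\Omega l(u(x))\,dx=\int_\Lambda l(y)\,dy$ for all $l\in C_c(\mathbb R^d)$. -/

import Mathlib

open MeasureTheory Set Topology
open scoped ENNReal ContDiff

noncomputable section

namespace PolyMin

/-- `ℝ^d` with the Euclidean norm. -/
abbrev Vec (d : ℕ) : Type := EuclideanSpace ℝ (Fin d)

/-- `ℝ^{d×d}` with the Frobenius inner product and norm; the entry in row `i`, column `j` of `ξ` is
`ξ (i, j)`. -/
abbrev Mat (d : ℕ) : Type := EuclideanSpace ℝ (Fin d × Fin d)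

/-- The values of the gradient of a matrix field: linear maps `v ↦ ∂_v φ`. -/
abbrev MatGrad (d : ℕ) : Type := Vec d →L[ℝ] Mat d

instance factOneLeOfReal (q : ℝ) [h : Fact (1 < q)] : Fact ((1 : ℝ≥0∞) ≤ ENNReal.ofReal q) :=
  ⟨by simpa using ENNReal.ofReal_le_ofReal h.out.le⟩

/-! ### Sobolev spaces of matrix fields -/

/-- The ambient space `L^q(Ω; ℝ^{d×d}) × L^q(Ω; L(ℝ^d, ℝ^{d×d}))` of pairs (field, gradient). -/
abbrev LqPair {d : ℕ} (Ω : Set (Vec d)) (q : ℝ) : Type :=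
  Lp (Mat d) (ENNReal.ofReal q) (volume.restrict Ω) ×
    Lp (MatGrad d) (ENNReal.ofReal q) (volume.restrict Ω)

/-- Smooth functions with compact support in `Ω`. -/
structure IsTest {d : ℕ} {V : Type*} [NormedAddCommGroup V] [NormedSpace ℝ V]
    (Ω : Set (Vec d)) (ψ : Vec d → V) : Prop where
  smooth : ContDiff ℝ ∞ ψ
  compact : HasCompactSupport ψ
  supp : tsupport ψ ⊆ Ω

/-- `G` is the weak gradient of `φ` on `Ω`. -/
def IsWeakGrad {d : ℕ} (Ω : Set (Vec d)) (φ : Vec d → Mat d) (G : Vec d → MatGrad d) : Prop :=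
  ∀ ψ : Vec d → ℝ, IsTest Ω ψ → ∀ v : Vec d,
    ∫ x in Ω, (fderiv ℝ ψ x v) • φ x = - ∫ x in Ω, ψ x • G x v

/-- The Sobolev space `W^{1,q}(Ω; ℝ^{d×d})`; an element is a field together with its
(uniquely determined) weak gradient, and the norm is equivalent to `‖φ‖_q + ‖∇φ‖_q`. -/
def sobolev {d : ℕ} (Ω : Set (Vec d)) (q : ℝ) [Fact (1 < q)] : Submodule ℝ (LqPair Ω q) where
  carrier := {w | IsWeakGrad Ω w.1 w.2}
  zero_mem' := by
    intro ψ _ v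
    have h1 : ∫ x in Ω, (fderiv ℝ ψ x v) • ((0 : LqPair Ω q).1 : Vec d → Mat d) x = 0 := by
      apply integral_eq_zero_of_ae
      filter_upwards [Lp.coeFn_zero (Mat d) (ENNReal.ofReal q) (volume.restrict Ω)] with x hx
      simp only [Prod.fst_zero, hx, Pi.zero_apply, smul_zero]
    have h2 : ∫ x in Ω, ψ x • ((0 : LqPair Ω q).2 : Vec d → MatGrad d) x v = 0 := by
      apply integral_eq_zero_of_ae
      filter_upwards [Lp.coeFn_zero (MatGrad d) (ENNReal.ofReal q) (volume.restrict Ω)] with x hx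
      simp only [Prod.snd_zero, hx, Pi.zero_apply, _root_.zero_apply, smul_zero]
    rw [h1, h2, neg_zero]
  add_mem' := by
    intro a b ha hb ψ hψ v
    have hq : (1 : ℝ≥0∞) ≤ ENNReal.ofReal q := Fact.out
    have hc1 : Continuous (fun x => fderiv ℝ ψ x v) :=
      (hψ.smooth.continuous_fderiv (by simp)).clm_apply continuous_const
    have hs1 : HasCompactSupport (fun x => fderiv ℝ ψ x v) := hψ.compact.fderiv_apply ℝ v
    have i1 : ∀ w : LqPair Ω q, Integrable (fun x => (fderiv ℝ ψ x v) • w.1 x)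
        (volume.restrict Ω) := fun w =>
      ((Lp.memLp w.1).locallyIntegrable hq).integrable_smul_left_of_hasCompactSupport hc1 hs1
    have i2 : ∀ w : LqPair Ω q, Integrable (fun x => ψ x • w.2 x v)
        (volume.restrict Ω) := fun w =>
      (((Lp.memLp w.2).locallyIntegrable hq).integrable_smul_left_of_hasCompactSupport
        hψ.smooth.continuous hψ.compact).apply_continuousLinearMap v
    have e1 : ∫ x in Ω, (fderiv ℝ ψ x v) • (a + b).1 x
        = ∫ x in Ω, ((fderiv ℝ ψ x v) • a.1 x + (fderiv ℝ ψ x v) • b.1 x) := by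
      apply integral_congr_ae
      filter_upwards [Lp.coeFn_add a.1 b.1] with x hx
      simp only [Prod.fst_add, hx, Pi.add_apply, smul_add]
    have e2 : ∫ x in Ω, ψ x • (a + b).2 x v
        = ∫ x in Ω, (ψ x • a.2 x v + ψ x • b.2 x v) := by
      apply integral_congr_ae
      filter_upwards [Lp.coeFn_add a.2 b.2] with x hx
      simp only [Prod.snd_add, hx, Pi.add_apply, _root_.add_apply, smul_add]
    rw [e1, e2, integral_add (i1 a) (i1 b), integral_add (i2 a) (i2 b), ha ψ hψ v, hb ψ hψ v]
    abel
  smul_mem' := by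
    intro c a ha ψ hψ v
    have e1 : ∫ x in Ω, (fderiv ℝ ψ x v) • (c • a).1 x
        = ∫ x in Ω, c • ((fderiv ℝ ψ x v) • a.1 x) := by
      apply integral_congr_ae
      filter_upwards [Lp.coeFn_smul c a.1] with x hx
      simp only [Prod.smul_fst, hx, Pi.smul_apply]
      rw [smul_comm]
    have e2 : ∫ x in Ω, ψ x • (c • a).2 x v = ∫ x in Ω, c • (ψ x • a.2 x v) := by
      apply integral_congr_ae
      filter_upwards [Lp.coeFn_smul c a.2] with x hx
      simp only [Prod.smul_snd, hx, Pi.smul_apply, _root_.smul_apply]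
      rw [smul_comm]
    rw [e1, e2, integral_smul, integral_smul, ha ψ hψ v, smul_neg]

/-- The pairs `(θ, ∇θ)` with `θ ∈ C_c^∞(Ω; ℝ^{d×d})`. -/
def testPairs {d : ℕ} (Ω : Set (Vec d)) (q : ℝ) : Set (LqPair Ω q) :=
  {w | ∃ θ : Vec d → Mat d, IsTest Ω θ ∧
    w.1 =ᵐ[volume.restrict Ω] θ ∧ w.2 =ᵐ[volume.restrict Ω] fderiv ℝ θ}

/-- `W_0^{1,q}(Ω; ℝ^{d×d})`: the closure of `C_c^∞(Ω; ℝ^{d×d})` in `W^{1,q}(Ω; ℝ^{d×d})`. -/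
def sobolevZero {d : ℕ} (Ω : Set (Vec d)) (q : ℝ) [Fact (1 < q)] : Submodule ℝ (LqPair Ω q) :=
  sobolev Ω q ⊓ (Submodule.span ℝ (testPairs Ω q)).topologicalClosure

/-- The field `φ` itself, as an element of `L^q`. -/
abbrev fld {d : ℕ} {Ω : Set (Vec d)} {q : ℝ} [Fact (1 < q)] (φ : sobolevZero Ω q) :
    Lp (Mat d) (ENNReal.ofReal q) (volume.restrict Ω) := φ.1.1

/-- Its weak gradient `∇φ`. -/
abbrev grd {d : ℕ} {Ω : Set (Vec d)} {q : ℝ} [Fact (1 < q)] (φ : sobolevZero Ω q) :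
    Lp (MatGrad d) (ENNReal.ofReal q) (volume.restrict Ω) := φ.1.2

/-- Row-wise trace of a gradient: `(∑_j ∂_j φ_{ij})_i`. -/
def rowTrace {d : ℕ} (A : MatGrad d) : Vec d :=
  WithLp.toLp 2 fun i => ∑ j, A (EuclideanSpace.single j 1) (i, j)

/-- The (row-wise) divergence of a matrix field. -/
def divg {d : ℕ} {Ω : Set (Vec d)} {q : ℝ} [Fact (1 < q)] (φ : sobolevZero Ω q) :
    Vec d → Vec d := fun x => rowTrace (grd φ x)

/-! ### Convex analysis -/

/-- The Legendre transform `f^*`, with values in `(-∞, ∞]`. -/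
def legendre {d : ℕ} (f : Mat d → ℝ) (η : Mat d) : EReal :=
  ⨆ ξ : Mat d, ((inner ℝ ξ η - f ξ : ℝ) : EReal)

/-- The subdifferential `∂h(x)` (for `x` with `h x` finite). -/
def subdiff {d : ℕ} (h : Mat d → EReal) (x : Mat d) : Set (Mat d) :=
  {y | ∀ z, h x + ((inner ℝ y (z - x) : ℝ) : EReal) ≤ h z}

/-- `y = grad[h](x)`: `y` is the element of minimal norm of `∂h(x)`. -/
def IsGrad {d : ℕ} (h : Mat d → EReal) (x y : Mat d) : Prop :=
  y ∈ subdiff h x ∧ ∀ z ∈ subdiff h x, ‖y‖ ≤ ‖z‖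

/-- The Lebesgue integral `∫_Ω g⁺ - ∫_Ω g⁻` of an extended-real function `g`. -/
def extIntegral {d : ℕ} (Ω : Set (Vec d)) (g : Vec d → EReal) : EReal :=
  ((∫⁻ x in Ω, (g x).toENNReal : ℝ≥0∞) : EReal) - ((∫⁻ x in Ω, (-g x).toENNReal : ℝ≥0∞) : EReal)

/-! ### Assumptions -/

/-- A map `g` on `Ω` is non-degenerate if preimages of Lebesgue null sets are null. -/
def NonDegenerate {d : ℕ} (Ω : Set (Vec d)) (g : Vec d → Vec d) : Prop :=
  ∀ N : Set (Vec d), volume N = 0 → volume (Ω ∩ g ⁻¹' N) = 0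

/-- The boundary of the open set `Ω` is smooth: near each boundary point `Ω` is a sublevel set of
a `C^∞` function with non-vanishing derivative. -/
def SmoothBoundary {d : ℕ} (Ω : Set (Vec d)) : Prop :=
  ∀ x ∈ frontier Ω, ∃ U ∈ 𝓝 x, ∃ ρ : Vec d → ℝ,
    ContDiff ℝ ∞ ρ ∧ fderiv ℝ ρ x ≠ 0 ∧ Ω ∩ U = {y | ρ y < 0} ∩ U

/-- The boundary of `Ω` is smooth and is the set of extreme points of the closure
of `Ω`. -/
structure SmoothExtremeBoundary {d : ℕ} (Ω : Set (Vec d)) : Prop where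
  smooth : SmoothBoundary Ω
  extreme : frontier Ω = (closure Ω).extremePoints ℝ

/-- The set `S_f` of all `φ ∈ S` for which `∫_Ω f^*(φ)` is finite. -/
def finiteEnergy {d : ℕ} {Ω : Set (Vec d)} {q : ℝ} [Fact (1 < q)] (f : Mat d → ℝ)
    (S : Set (sobolevZero Ω q)) : Set (sobolevZero Ω q) :=
  {φ ∈ S | extIntegral Ω (fun x => legendre f (fld φ x)) ≠ ⊤ ∧
    extIntegral Ω (fun x => legendre f (fld φ x)) ≠ ⊥}

/-- The assumptions on the integrand `f` (and `S`): convexity, growth of `f` and of its subgradients,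
`S_f` non-empty, and either strict convexity or `grad[f^*] = 0` on the domain of `f^*`. -/
structure AdmissibleIntegrand {d : ℕ} {Ω : Set (Vec d)} (p : ℝ) {q : ℝ} [Fact (1 < q)] (f : Mat d → ℝ)
    (S : Set (sobolevZero Ω q)) : Prop where
  convex : ConvexOn ℝ univ f
  growth : ∃ a b c : ℝ, 0 < a ∧ 0 < b ∧ 0 < c ∧
    (∀ ξ, f ξ ≤ c * (‖ξ‖ ^ p / p) + b ∧ a * ‖ξ‖ - b ≤ f ξ) ∧
    ∀ ξ, ∀ η ∈ subdiff (fun ζ => (f ζ : EReal)) ξ, ‖η‖ ^ q ≤ c * ‖ξ‖ ^ p + b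
  nonempty : (finiteEnergy f S).Nonempty
  strict_or : StrictConvexOn ℝ univ f ∨
    ∀ η, legendre f η ≠ ⊤ → (subdiff (legendre f) η).Nonempty ∧ IsGrad (legendre f) η 0

/-- The condition (ND)_S: `div φ + F` is non-degenerate for all `φ ∈ S`. -/
def ConditionND {d : ℕ} {Ω : Set (Vec d)} {q : ℝ} [Fact (1 < q)] (F : Vec d → Vec d)
    (S : Set (sobolevZero Ω q)) : Prop :=
  ∀ φ ∈ S, NonDegenerate Ω (fun x => divg φ x + F x)

/-! ### The minimization problem -/

/-- The set `U_S` of displacements: measurable `u : Ω → closure Λ` (up to null sets) with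
`|∫_Ω u · div φ| ≤ c ‖φ‖_{L^q}` on `S` for some constant `c`. -/
def displacements {d : ℕ} {Ω : Set (Vec d)} (Λ : Set (Vec d)) {q : ℝ} [Fact (1 < q)]
    (S : Set (sobolevZero Ω q)) : Set (Vec d → Vec d) :=
  {u | AEMeasurable u (volume.restrict Ω) ∧ (∀ᵐ x ∂volume.restrict Ω, u x ∈ closure Λ) ∧
    ∃ c : ℝ, 0 < c ∧ ∀ φ ∈ S, |∫ x in Ω, inner ℝ (u x) (divg φ x)| ≤ c * ‖fld φ‖}

/-- The set `U_S^1` of measure-preserving (incompressible) displacements. -/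
def incompressible {d : ℕ} {Ω : Set (Vec d)} (Λ : Set (Vec d)) {q : ℝ} [Fact (1 < q)]
    (S : Set (sobolevZero Ω q)) : Set (Vec d → Vec d) :=
  {u ∈ displacements Λ S | ∀ l : Vec d → ℝ, Continuous l → HasCompactSupport l →
    ∫ x in Ω, l (u x) = ∫ y in Λ, l y}

/-- `V_S^f(u) = sup_{φ ∈ S} ∫_Ω (-u · div φ - f^*(φ))`. -/
def pseudoEnergy {d : ℕ} {Ω : Set (Vec d)} {q : ℝ} [Fact (1 < q)] (f : Mat d → ℝ)
    (S : Set (sobolevZero Ω q)) (u : Vec d → Vec d) : EReal :=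
  ⨆ φ ∈ S, (((-∫ x in Ω, inner ℝ (u x) (divg φ x) : ℝ) : EReal)
    - extIntegral Ω (fun x => legendre f (fld φ x)))

/-- The functional `I_0(u) = V_S^f(u) - ∫_Ω F · u`. -/
def energy {d : ℕ} {Ω : Set (Vec d)} {q : ℝ} [Fact (1 < q)] (f : Mat d → ℝ)
    (F : Vec d → Vec d) (S : Set (sobolevZero Ω q)) (u : Vec d → Vec d) : EReal :=
  pseudoEnergy f S u - ((∫ x in Ω, inner ℝ (F x) (u x) : ℝ) : EReal)

/-- `u` minimizes `I_0` over the incompressible displacements. -/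
def IsMinimizer {d : ℕ} {Ω : Set (Vec d)} (Λ : Set (Vec d)) {q : ℝ} [Fact (1 < q)]
    (f : Mat d → ℝ) (F : Vec d → Vec d) (S : Set (sobolevZero Ω q)) (u : Vec d → Vec d) : Prop :=
  u ∈ incompressible Λ S ∧ ∀ v ∈ incompressible Λ S, energy f F S u ≤ energy f F S v

end PolyMin

end

/-! Let `μ` and `ν` be Lebesgue measure on `Ω` and `Λ`. Condition (ND) survives adding `F` because
the preimage of a null set under `div φ + F` lies in a countable union of preimages under `div φ` of
translated null sets (`NonDegenerate.add_countable`).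

For the minimization, the energy of `u` is the supremum over `φ` of `-∫ u · (div φ + F) - ∫ f^*(φ)`.
Exchanging infimum and supremum formally leaves an inner maximum of `∫ u · (div φ + F)` over maps
`u` carrying `μ` to `ν`. That is an optimal transport problem, with dual: minimize `∫ ψ(div φ + F) +
∫ χ dν` subject to `⟪x, y⟫ ≤ ψ x + χ y`. Hence the joint dual problem in `(φ, ψ, χ)`, with value
`dualValue`. It has a minimizer (`exists_feasible_minimizer`): `f^*` is superlinear, so the fields
stay bounded in the finite dimensional span; the potentials `ψ` are equi-Lipschitz; the `χ` are
handled by Fatou.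

No minimax theorem is needed, since the optimality conditions at a dual minimizer give a saddle
point. Put `g = div φ₀ + F` and `u₀ = ∇ψ ∘ g`, which makes sense a.e. by Rademacher and (ND).
Varying `χ` shows that `u₀` carries `μ` to `ν` (`exists_unique_optimal_map`); varying `φ` shows that
`φ₀` attains the supremum defining the pseudo-energy of `u₀` (`energy_le_of_dual_minimizer`).
Testing the supremum of any competitor with `φ₀` and using that `u₀` maximizes `∫ u · g` gives
minimality. Another minimizer must also maximize `∫ u · g`; equality in Fenchel–Young then forces `u
= ∇ψ ∘ g` a.e. -/

noncomputable section

namespace PolyMin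

/-! ### Legendre transforms over a bounded set and their first variation -/

section SupConj

variable {E : Type*} [NormedAddCommGroup E] [InnerProductSpace ℝ E]

/-- The Legendre transform of `χ` restricted to the set `D`. -/
def supConj (D : Set E) (χ : E → ℝ) (x : E) : ℝ := ⨆ y : D, (inner ℝ x (y : E) - χ y)

variable {D : Set E} {χ : E → ℝ} {R b : ℝ}

lemma bddAbove_supConj (hD : D ⊆ Metric.closedBall 0 R) (hχ : ∀ y ∈ D, b ≤ χ y) (x : E) :
    BddAbove (range fun y : D => inner ℝ x (y : E) - χ y) := by
  refine ⟨‖x‖ * R - b, ?_⟩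
  rintro _ ⟨y, rfl⟩
  have h1 : ‖(y : E)‖ ≤ R := by simpa using hD y.2
  have h2 := real_inner_le_norm x (y : E)
  have h3 := mul_le_mul_of_nonneg_left h1 (norm_nonneg x)
  have h4 := hχ y y.2
  simp only
  linarith

lemma le_supConj (hD : D ⊆ Metric.closedBall 0 R) (hχ : ∀ y ∈ D, b ≤ χ y) (x : E) {y : E}
    (hy : y ∈ D) : inner ℝ x y - χ y ≤ supConj D χ x :=
  le_ciSup (bddAbove_supConj hD hχ x) ⟨y, hy⟩

lemma supConj_le (hne : D.Nonempty) {x : E} {a : ℝ} (h : ∀ y ∈ D, inner ℝ x y - χ y ≤ a) :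
    supConj D χ x ≤ a :=
  haveI := hne.to_subtype
  ciSup_le fun y => h y y.2

lemma exists_lt_supConj (hne : D.Nonempty) (x : E) {δ : ℝ} (hδ : 0 < δ) :
    ∃ y ∈ D, supConj D χ x - δ < inner ℝ x y - χ y := by
  by_contra! h
  have := supConj_le hne h
  linarith

lemma lipschitzWith_supConj (hD : D ⊆ Metric.closedBall 0 R)
    (hχ : ∀ y ∈ D, b ≤ χ y) (hne : D.Nonempty) : LipschitzWith R.toNNReal (supConj D χ) := by
  refine LipschitzWith.of_le_add_mul' R fun x z => supConj_le hne fun y hy => ?_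
  have h1 : ‖y‖ ≤ R := by simpa using hD hy
  have h2 := real_inner_le_norm (x - z) y
  have h3 := mul_le_mul_of_nonneg_left h1 (norm_nonneg (x - z))
  have h4 := le_supConj hD hχ z hy
  rw [inner_sub_left] at h2
  rw [dist_eq_norm]
  linarith

variable [CompleteSpace E]

/-- At a point of differentiability, near-maximizers are close to the gradient. -/
lemma exists_near_maximizer_close (hD : D ⊆ Metric.closedBall 0 R) (hχ : ∀ y ∈ D, b ≤ χ y)
    {x : E} (hx : DifferentiableAt ℝ (supConj D χ) x) {η : ℝ} (hη : 0 < η) :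
    ∃ δ > 0, ∀ y ∈ D, supConj D χ x - δ < inner ℝ x y - χ y →
      ‖y - gradient (supConj D χ) x‖ < η := by
  set h := supConj D χ with hh
  set y₀ := gradient h x with hy₀
  have hg := hx.hasGradientAt
  rw [hasGradientAt_iff_isLittleO, Asymptotics.isLittleO_iff] at hg
  have h4 : 0 < η / 4 := by positivity
  obtain ⟨ρ, hρ, hball⟩ := Metric.eventually_nhds_iff.1 (hg h4)
  -- A step of length `ρ / 2` from `x` towards `y - y₀` raises the affine function of `y` by `ρ / 2
  -- * ‖y - y₀‖` more than the linearization of `h`. The slack available is `δ` plus the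
  -- differentiability error `η / 4 * (ρ / 2)`, in total `ρ * η / 4`, which is too small if `‖y -
  -- y₀‖ ≥ η`.
  refine ⟨η * (ρ / 2) / 4, by positivity, fun y hy hyδ => ?_⟩
  by_contra! hc
  have hn : 0 < ‖y - y₀‖ := hη.trans_le hc
  set t := (ρ / 2) / ‖y - y₀‖ with ht
  have htp : 0 < t := by positivity
  have htn : t * ‖y - y₀‖ = ρ / 2 := by rw [ht]; field_simp
  have hv : ‖t • (y - y₀)‖ = ρ / 2 := by rw [norm_smul, Real.norm_of_nonneg htp.le, htn]
  have h1 := hball (y := x + t • (y - y₀)) (by rw [dist_eq_norm, add_sub_cancel_left, hv]; linarith)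
  rw [add_sub_cancel_left, hv, Real.norm_eq_abs] at h1
  have h2 := le_of_abs_le h1
  have h3 := le_supConj hD hχ (x + t • (y - y₀)) hy
  rw [← hh] at h3
  rw [inner_add_left, inner_smul_left] at h3
  rw [inner_smul_right] at h2
  have h5 : inner ℝ (y - y₀) y - inner ℝ y₀ (y - y₀) = ‖y - y₀‖ ^ 2 := by
    rw [← real_inner_self_eq_norm_sq, inner_sub_left, inner_sub_left, inner_sub_right,
      inner_sub_right, real_inner_comm y y₀]
  simp only [conj_trivial] at h3
  have h6 : t * ‖y - y₀‖ ^ 2 = ρ / 2 * ‖y - y₀‖ := by rw [← htn]; ring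
  have h7 : t * inner ℝ (y - y₀) y - t * inner ℝ y₀ (y - y₀) = ρ / 2 * ‖y - y₀‖ := by
    rw [← h6, ← h5]; ring
  have h8 : ρ / 2 * η ≤ ρ / 2 * ‖y - y₀‖ := by gcongr
  have h9 : 0 < ρ * η := by positivity
  linarith

/-- Near-maximizers at `x` give affine minorants that are almost exact at `x`, and their slopes tend
to the gradient. Neither closedness of `D` nor attainment of the supremum is needed. -/
lemma supConj_add_inner_gradient_le (hD : D ⊆ Metric.closedBall 0 R) (hχ : ∀ y ∈ D, b ≤ χ y)
    (hne : D.Nonempty) {x : E} (hx : DifferentiableAt ℝ (supConj D χ) x) (z : E) :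
    supConj D χ x + inner ℝ (z - x) (gradient (supConj D χ) x) ≤ supConj D χ z := by
  refine le_of_forall_pos_le_add fun κ hκ => ?_
  have hη : 0 < κ / 2 / (‖z - x‖ + 1) := by positivity
  obtain ⟨δ, hδ, hclose⟩ := exists_near_maximizer_close hD hχ hx hη
  obtain ⟨y, hy, hlt⟩ := exists_lt_supConj (χ := χ) hne x (lt_min hδ (half_pos hκ))
  have h1 := hclose y hy (by linarith [min_le_left δ (κ / 2)])
  have h2 := le_supConj hD hχ z hy
  have h3 := abs_real_inner_le_norm (z - x) (y - gradient (supConj D χ) x)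
  have h4 : ‖z - x‖ * ‖y - gradient (supConj D χ) x‖ ≤ κ / 2 := by
    calc _ ≤ (‖z - x‖ + 1) * (κ / 2 / (‖z - x‖ + 1)) := by gcongr; linarith
      _ = κ / 2 := by field_simp
  have h5 := neg_le_of_abs_le h3
  rw [inner_sub_right, inner_sub_left (𝕜 := ℝ) z x y] at h5
  linarith [min_le_right δ (κ / 2)]

/-- First variation of the Legendre transform under perturbation of `χ`. -/
lemma tendsto_supConj_perturb (hD : D ⊆ Metric.closedBall 0 R) (hχ : ∀ y ∈ D, b ≤ χ y)
    (hne : D.Nonempty) {x : E} (hx : DifferentiableAt ℝ (supConj D χ) x) {l : E → ℝ}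
    (hl : Continuous l) {B : ℝ} (hB : ∀ y, |l y| ≤ B) :
    Filter.Tendsto (fun ε : ℝ => (supConj D (fun y => χ y + ε * l y) x - supConj D χ x) / ε)
      (𝓝[>] 0) (𝓝 (-l (gradient (supConj D χ) x))) := by
  set y₀ := gradient (supConj D χ) x with hy₀
  have hB0 : 0 ≤ B := (abs_nonneg _).trans (hB 0)
  rw [Metric.tendsto_nhds]
  intro κ' hκ'
  obtain ⟨κ, hκ, hκκ⟩ : ∃ κ > 0, 2 * κ < κ' := ⟨κ' / 3, by positivity, by linarith⟩
  obtain ⟨η, hη, hlη⟩ := Metric.continuous_iff.1 hl y₀ κ hκ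
  obtain ⟨δ, hδ, hclose⟩ := exists_near_maximizer_close hD hχ hx hη
  have hsmall : ∀ᶠ ε : ℝ in 𝓝[>] 0, ε * (2 * B) < δ := by
    have : Filter.Tendsto (fun ε : ℝ => ε * (2 * B)) (𝓝[>] 0) (𝓝 0) := by
      have := ((continuous_mul_const (2 * B)).tendsto (0 : ℝ)).mono_left
        (nhdsWithin_le_nhds (s := Ioi 0))
      rwa [zero_mul] at this
    exact this.eventually_lt_const hδ
  filter_upwards [hsmall, self_mem_nhdsWithin] with ε hεδ hε
  have hε : 0 < ε := hε
  have hχε : ∀ y ∈ D, b - ε * B ≤ χ y + ε * l y := fun y hy => by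
    have h1 := neg_le_of_abs_le (hB y)
    have := mul_le_mul_of_nonneg_left h1 hε.le
    linarith [hχ y hy]
  -- If `y` is within `δ` of maximal, it is so close to `y₀` that `l y` is within `κ` of `l y₀`.
  -- Otherwise the gap `δ > 2 * ε * B` outweighs any change caused by `ε * l`.
  have hup : supConj D (fun y => χ y + ε * l y) x ≤ supConj D χ x - ε * l y₀ + ε * κ := by
    refine supConj_le hne fun y hy => ?_
    by_cases hc : supConj D χ x - δ < inner ℝ x y - χ y
    · have h1 := hlη y (by rw [dist_eq_norm]; exact hclose y hy hc)
      rw [Real.dist_eq] at h1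
      have h2 := (abs_lt.1 h1).1
      have h3 := mul_lt_mul_of_pos_left h2 hε
      have h4 := le_supConj hD hχ x hy
      linarith
    · have h1 := neg_le_of_abs_le (hB y)
      have h2 := le_of_abs_le (hB y₀)
      have h3 := mul_le_mul_of_nonneg_left h1 hε.le
      have h4 := mul_le_mul_of_nonneg_left h2 hε.le
      have : 0 < ε * κ := by positivity
      linarith
  have hlo : supConj D χ x - ε * l y₀ - 2 * (ε * κ) ≤ supConj D (fun y => χ y + ε * l y) x := by
    have hεκ : 0 < ε * κ := by positivity
    obtain ⟨y, hy, hlt⟩ := exists_lt_supConj (χ := χ) hne x (lt_min hδ hεκ)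
    have h0 := hclose y hy (by linarith [min_le_left δ (ε * κ)])
    have h1 := hlη y (by rw [dist_eq_norm]; exact h0)
    rw [Real.dist_eq] at h1
    have h2 := (abs_lt.1 h1).2
    have h3 := mul_lt_mul_of_pos_left h2 hε
    have h4 := le_supConj hD hχε x hy
    linarith [min_le_right δ (ε * κ)]
  have : dist ((supConj D (fun y => χ y + ε * l y) x - supConj D χ x) / ε) (-l y₀) ≤ 2 * κ := by
    rw [Real.dist_eq, sub_neg_eq_add, abs_le]
    constructor
    · rw [← sub_le_iff_le_add, le_div_iff₀ hε]
      linarith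
    · rw [← le_sub_iff_add_le, div_le_iff₀ hε]
      have : 0 < ε * κ := by positivity
      linarith
  linarith

omit [CompleteSpace E] in
lemma abs_supConj_perturb_sub_le (hD : D ⊆ Metric.closedBall 0 R) (hχ : ∀ y ∈ D, b ≤ χ y)
    (hne : D.Nonempty) (x : E) {l : E → ℝ} {B : ℝ} (hB : ∀ y, |l y| ≤ B) {ε : ℝ} (hε : 0 ≤ ε) :
    |supConj D (fun y => χ y + ε * l y) x - supConj D χ x| ≤ ε * B := by
  have key : ∀ y, |ε * l y| ≤ ε * B := fun y => by
    rw [abs_mul, abs_of_nonneg hε]; exact mul_le_mul_of_nonneg_left (hB y) hε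
  have hχε : ∀ y ∈ D, b - ε * B ≤ χ y + ε * l y := fun y hy => by
    linarith [hχ y hy, neg_le_of_abs_le (key y)]
  rw [abs_le]
  constructor
  · have : supConj D χ x ≤ supConj D (fun y => χ y + ε * l y) x + ε * B :=
      supConj_le hne fun y hy => by
        linarith [le_supConj hD hχε x hy, le_of_abs_le (key y)]
    linarith
  · have : supConj D (fun y => χ y + ε * l y) x ≤ supConj D χ x + ε * B :=
      supConj_le hne fun y hy => by
        linarith [le_supConj hD hχ x hy, neg_le_of_abs_le (key y)]
    linarith

end SupConj

/-! ### Optimal transport to `ν` by first variation of the dual potentials -/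

section Transport

variable {d : ℕ} {X : Type*} [MeasurableSpace X] {μ : Measure X} {ν : Measure (Vec d)} {R : ℝ}

/-- Admissible pairs in the dual of the optimal transport problem with target `ν`. -/
structure DualPair (ν : Measure (Vec d)) (R : ℝ) (ψ χ : Vec d → ℝ) : Prop where
  lipschitz : LipschitzWith R.toNNReal ψ
  integrable : Integrable χ ν
  le : ∀ᵐ y ∂ν, ∀ x, inner ℝ x y ≤ ψ x + χ y

lemma map_eq_of_integral_eq [IsFiniteMeasure μ] [IsFiniteMeasure ν] {u : X → Vec d}
    (hu : AEMeasurable u μ)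
    (h : ∀ l : Vec d → ℝ, Continuous l → HasCompactSupport l → ∫ x, l (u x) ∂μ = ∫ y, l y ∂ν) :
    μ.map u = ν := by
  refine Measure.ext_of_integral_eq_on_compactlySupported fun l => ?_
  rw [integral_map hu (f := l) l.continuous.aestronglyMeasurable]
  exact h l l.continuous l.hasCompactSupport

lemma integrable_lipschitz_comp {ψ : Vec d → ℝ} {K : NNReal} (hψ : LipschitzWith K ψ)
    [IsFiniteMeasure μ] {g : X → Vec d} (hg : Integrable g μ) :
    Integrable (fun x => ψ (g x)) μ := by
  refine Integrable.mono' ((hg.norm.const_mul K).add (integrable_const |ψ 0|))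
    (hψ.continuous.comp_aestronglyMeasurable hg.1) (Filter.Eventually.of_forall fun x => ?_)
  have h1 := hψ.dist_le_mul (g x) 0
  rw [Real.dist_eq, dist_zero_right] at h1
  have h2 := abs_sub_abs_le_abs_sub (ψ (g x)) (ψ 0)
  simp only [Real.norm_eq_abs, Pi.add_apply]
  linarith

lemma integrable_inner_of_norm_le {u g : X → Vec d} (hu : AEMeasurable u μ)
    (hR : ∀ᵐ x ∂μ, ‖u x‖ ≤ R) (hg : Integrable g μ) :
    Integrable (fun x => inner ℝ (u x) (g x)) μ := by
  refine Integrable.mono' (hg.norm.const_mul R) (hu.aestronglyMeasurable.inner hg.1) ?_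
  filter_upwards [hR] with x hx
  exact (norm_inner_le_norm _ _).trans (mul_le_mul_of_nonneg_right hx (norm_nonneg _))

/-- The Legendre transform over a countable dense set. -/
def denseConj (ψ : Vec d → ℝ) (y : Vec d) : ℝ :=
  ⨆ n : ℕ, (inner ℝ (TopologicalSpace.denseSeq (Vec d) n) y - ψ (TopologicalSpace.denseSeq (Vec d) n))

lemma measurable_denseConj (ψ : Vec d → ℝ) : Measurable (denseConj ψ) :=
  Measurable.iSup fun _ => (Measurable.inner measurable_const measurable_id).sub_const _

lemma denseConj_le {ψ : Vec d → ℝ} {y : Vec d} {c : ℝ} (h : ∀ x, inner ℝ x y ≤ ψ x + c) :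
    denseConj ψ y ≤ c :=
  ciSup_le fun n => by linarith [h (TopologicalSpace.denseSeq (Vec d) n)]

/-- The inequality passes from the dense sequence to all `x` by continuity. The constant `c` only
ensures that the real supremum is bounded, hence not the default value `0`. -/
lemma le_denseConj {ψ : Vec d → ℝ} (hψ : Continuous ψ) {y : Vec d} {c : ℝ}
    (h : ∀ x, inner ℝ x y ≤ ψ x + c) (x : Vec d) : inner ℝ x y ≤ ψ x + denseConj ψ y := by
  have hb : BddAbove (range fun n : ℕ => inner ℝ (TopologicalSpace.denseSeq (Vec d) n) y
      - ψ (TopologicalSpace.denseSeq (Vec d) n)) := by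
    refine ⟨c, ?_⟩
    rintro _ ⟨n, rfl⟩
    simp only
    linarith [h (TopologicalSpace.denseSeq (Vec d) n)]
  have hcl : IsClosed {x | inner ℝ x y ≤ ψ x + denseConj ψ y} :=
    isClosed_le (continuous_id.inner continuous_const) (hψ.add continuous_const)
  have hsub : range (TopologicalSpace.denseSeq (Vec d)) ⊆
      {x | inner ℝ x y ≤ ψ x + denseConj ψ y} := by
    rintro _ ⟨n, rfl⟩
    have := le_ciSup hb n
    simp only [mem_ofPred_eq, denseConj]
    linarith
  have := closure_minimal hsub hcl
  rw [(TopologicalSpace.denseRange_denseSeq (Vec d)).closure_range] at this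
  exact this (mem_univ x)

variable [IsFiniteMeasure μ] [IsFiniteMeasure ν]

/-- Optimal dual potentials yield the optimal measure preserving rearrangement. -/
theorem exists_unique_optimal_map (hν0 : ν ≠ 0) (hνR : ∀ᵐ y ∂ν, ‖y‖ ≤ R)
    {g : X → Vec d} (hg : Integrable g μ)
    (hnd : ∀ N : Set (Vec d), volume N = 0 → ∀ᵐ x ∂μ, g x ∉ N)
    {ψ₁ χ : Vec d → ℝ} (hpair : DualPair ν R ψ₁ χ)
    (hmin : ∀ ψ' χ' : Vec d → ℝ, DualPair ν R ψ' χ' →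
      ∫ x, ψ₁ (g x) ∂μ + ∫ y, χ y ∂ν ≤ ∫ x, ψ' (g x) ∂μ + ∫ y, χ' y ∂ν) :
    ∃ ψ : Vec d → ℝ, DualPair ν R ψ χ ∧ ∫ x, ψ (g x) ∂μ = ∫ x, ψ₁ (g x) ∂μ ∧
      (∀ᵐ x ∂μ, DifferentiableAt ℝ ψ (g x)) ∧
      AEMeasurable (fun x => gradient ψ (g x)) μ ∧
      μ.map (fun x => gradient ψ (g x)) = ν ∧
      ∀ u : X → Vec d, AEMeasurable u μ → μ.map u = ν →
        ∫ x, inner ℝ (u x) (g x) ∂μ ≤ ∫ x, inner ℝ (gradient ψ (g x)) (g x) ∂μ ∧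
        (∫ x, inner ℝ (gradient ψ (g x)) (g x) ∂μ ≤ ∫ x, inner ℝ (u x) (g x) ∂μ →
          u =ᵐ[μ] fun x => gradient ψ (g x)) := by
  -- Restricting to the points where the constraint really holds loses only a `ν`-null set. It makes
  -- `χ` bounded below on `D` and gives `supConj D χ ≤ ψ₁` everywhere, so the new pair is still
  -- optimal.
  set D : Set (Vec d) := {y | ‖y‖ ≤ R ∧ ∀ x, inner ℝ x y ≤ ψ₁ x + χ y} with hDdef
  have hDae : ∀ᵐ y ∂ν, y ∈ D := by
    filter_upwards [hνR, hpair.le] with y h1 h2 using ⟨h1, h2⟩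
  have hne : D.Nonempty := by
    have : (ae ν).NeBot := ae_neBot.2 hν0
    exact hDae.exists
  have hD : D ⊆ Metric.closedBall 0 R := fun y hy => by simpa using hy.1
  have hχ : ∀ y ∈ D, -ψ₁ 0 ≤ χ y := fun y hy => by
    have := hy.2 0
    rw [inner_zero_left] at this
    linarith
  set ψ := supConj D χ with hψdef
  have hlip := lipschitzWith_supConj hD hχ hne
  have hpairψ : DualPair ν R ψ χ := ⟨hlip, hpair.integrable, by
    filter_upwards [hDae] with y hy x
    linarith [le_supConj hD hχ x hy]⟩
  have hle : ∀ x, ψ x ≤ ψ₁ x := fun x => supConj_le hne fun y hy => by linarith [hy.2 x]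
  have hint : Integrable (fun x => ψ (g x)) μ := integrable_lipschitz_comp hlip hg
  have hint₁ : Integrable (fun x => ψ₁ (g x)) μ :=
    integrable_lipschitz_comp hpair.lipschitz hg
  have heq : ∫ x, ψ (g x) ∂μ = ∫ x, ψ₁ (g x) ∂μ := by
    refine le_antisymm (integral_mono hint hint₁ fun x => hle _) ?_
    linarith [hmin ψ χ hpairψ]
  -- Rademacher's exceptional set is null, and non-degeneracy of `g` keeps its preimage null.
  have hdiff : ∀ᵐ x ∂μ, DifferentiableAt ℝ ψ (g x) := by
    have h1 := hlip.ae_differentiableAt (μ := (volume : Measure (Vec d)))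
    filter_upwards [hnd _ (ae_iff.1 h1)] with x hx
    simpa using hx
  have hmeas : AEMeasurable (fun x => gradient ψ (g x)) μ := by
    have : Measurable (gradient ψ) :=
      (InnerProductSpace.toDual ℝ (Vec d)).symm.continuous.measurable.comp (measurable_fderiv ℝ ψ)
    exact this.comp_aemeasurable hg.1.aemeasurable
  -- Replace `χ` by `χ + ε * l` and `ψ` by its transform: the pair stays admissible, so the right
  -- derivative of the value at `ε = 0` is nonnegative. Using `-l` as well later gives equality.
  have hEL : ∀ (l : Vec d → ℝ), Continuous l → ∀ B : ℝ, (∀ y, |l y| ≤ B) →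
      ∫ x, l (gradient ψ (g x)) ∂μ ≤ ∫ y, l y ∂ν := by
    intro l hl B hB
    have hlint : Integrable l ν := Integrable.mono' (integrable_const B)
      hl.aestronglyMeasurable (Filter.Eventually.of_forall hB)
    have hlipε : ∀ ε : ℝ, 0 ≤ ε →
        LipschitzWith R.toNNReal (supConj D fun y => χ y + ε * l y) := fun ε hε => by
      refine lipschitzWith_supConj (b := -ψ₁ 0 - ε * B) hD (fun y hy => ?_) hne
      have h1 := mul_le_mul_of_nonneg_left (neg_le_of_abs_le (hB y)) hε
      linarith [hχ y hy]
    have hlim : Filter.Tendsto (fun ε : ℝ =>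
        ∫ x, (supConj D (fun y => χ y + ε * l y) (g x) - ψ (g x)) / ε ∂μ) (𝓝[>] 0)
        (𝓝 (∫ x, -l (gradient ψ (g x)) ∂μ)) := by
      refine tendsto_integral_filter_of_dominated_convergence (fun _ => B) ?_ ?_
        (integrable_const B) ?_
      · filter_upwards [self_mem_nhdsWithin] with ε hε
        exact (((integrable_lipschitz_comp
          (hlipε ε (le_of_lt hε)) hg).sub hint).div_const ε).1
      · filter_upwards [self_mem_nhdsWithin] with ε hε
        refine Filter.Eventually.of_forall fun x => ?_
        have hε : 0 < ε := hε
        rw [Real.norm_eq_abs, abs_div, abs_of_pos hε, div_le_iff₀ hε, mul_comm B]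
        exact abs_supConj_perturb_sub_le hD hχ hne (g x) hB hε.le
      · filter_upwards [hdiff] with x hx
        exact tendsto_supConj_perturb hD hχ hne hx hl hB
    have hge : -∫ y, l y ∂ν ≤ ∫ x, -l (gradient ψ (g x)) ∂μ := by
      refine ge_of_tendsto hlim ?_
      filter_upwards [self_mem_nhdsWithin] with ε hε
      have hε : 0 < ε := hε
      have hi := integrable_lipschitz_comp (hlipε ε hε.le) hg
      rw [integral_div, integral_sub hi hint, le_div_iff₀ hε]
      have h1 := hmin _ (fun y => χ y + ε * l y) ⟨hlipε ε hε.le,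
        hpair.integrable.add (hlint.const_mul ε), by
          filter_upwards [hDae] with y hy x
          have h2 := le_supConj (χ := fun y => χ y + ε * l y) (b := -ψ₁ 0 - ε * B) hD
            (fun y hy => by
              have h1 := mul_le_mul_of_nonneg_left (neg_le_of_abs_le (hB y)) hε.le
              linarith [hχ y hy]) x hy
          linarith⟩
      rw [integral_add hpair.integrable (hlint.const_mul ε), integral_const_mul] at h1
      linarith
    rw [integral_neg] at hge
    linarith
  have hmap : μ.map (fun x => gradient ψ (g x)) = ν := by
    refine map_eq_of_integral_eq hmeas fun l hl hlc => ?_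
    obtain ⟨B, hB⟩ := hl.bounded_above_of_compact_support hlc
    refine le_antisymm (hEL l hl B hB) ?_
    have := hEL (fun y => -l y) hl.neg B (fun y => by rw [abs_neg]; exact hB y)
    rw [integral_neg, integral_neg] at this
    linarith
  -- From here the conjugate of `ψ` replaces `χ`, which may exceed it: the conjugate gives equality
  -- in Fenchel–Young at the gradient. It is measurable, and `ν`-a.e. squeezed between `-ψ 0` and
  -- `χ`.
  have hχ₁ : Integrable (denseConj ψ) ν := by
    refine Integrable.mono' (hpair.integrable.norm.add (integrable_const |ψ 0|))
      (measurable_denseConj ψ).aestronglyMeasurable ?_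
    filter_upwards [hpairψ.le] with y hy
    have h1 := denseConj_le hy
    have h2 := le_denseConj hlip.continuous hy 0
    rw [inner_zero_left] at h2
    simp only [Real.norm_eq_abs, Pi.add_apply]
    rw [abs_le]
    constructor
    · linarith [le_abs_self (ψ 0), abs_nonneg (χ y)]
    · linarith [le_abs_self (χ y), abs_nonneg (ψ 0)]
  have hcomp : ∀ u : X → Vec d, AEMeasurable u μ → μ.map u = ν →
      Integrable (fun x => denseConj ψ (u x)) μ ∧
      ∫ x, denseConj ψ (u x) ∂μ = ∫ y, denseConj ψ y ∂ν ∧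
      (∀ᵐ x ∂μ, ∀ z, inner ℝ z (u x) ≤ ψ z + denseConj ψ (u x)) ∧
      Integrable (fun x => inner ℝ (u x) (g x)) μ := by
    intro u hu hmu
    have hχ₁' := hχ₁
    rw [← hmu] at hχ₁'
    refine ⟨hχ₁'.comp_aemeasurable hu, ?_, ?_, ?_⟩
    · rw [← integral_map hu (measurable_denseConj ψ).aestronglyMeasurable, hmu]
    · have h1 := hpairψ.le
      rw [← hmu] at h1
      filter_upwards [ae_of_ae_map hu h1] with x hx z using le_denseConj hlip.continuous hx z
    · have h1 := hνR
      rw [← hmu] at h1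
      exact integrable_inner_of_norm_le hu (ae_of_ae_map hu h1) hg
  refine ⟨ψ, hpairψ, heq, hdiff, hmeas, hmap, fun u hu hmu => ?_⟩
  obtain ⟨hu1, hu2, hu3, hu4⟩ := hcomp u hu hmu
  obtain ⟨hv1, hv2, hv3, hv4⟩ := hcomp _ hmeas hmap
  have hvle : ∫ x, ψ (g x) ∂μ + ∫ y, denseConj ψ y ∂ν ≤
      ∫ x, inner ℝ (gradient ψ (g x)) (g x) ∂μ := by
    rw [← hv2, ← integral_add hint hv1]
    refine integral_mono_ae (hint.add hv1) hv4 ?_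
    filter_upwards [hdiff] with x hx
    have h1 : ∀ z, inner ℝ z (gradient ψ (g x)) ≤
        ψ z + (inner ℝ (g x) (gradient ψ (g x)) - ψ (g x)) := fun z => by
      have := supConj_add_inner_gradient_le hD hχ hne hx z
      rw [inner_sub_left] at this
      linarith
    have h2 := denseConj_le h1
    simp only [real_inner_comm (g x)]
    linarith
  have hule : ∫ x, inner ℝ (u x) (g x) ∂μ ≤ ∫ x, ψ (g x) ∂μ + ∫ y, denseConj ψ y ∂ν := by
    rw [← hu2, ← integral_add hint hu1]
    refine integral_mono_ae hu4 (hint.add hu1) ?_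
    filter_upwards [hu3] with x hx
    rw [real_inner_comm]
    exact hx (g x)
  refine ⟨hule.trans hvle, fun hge => ?_⟩
  -- The Fenchel–Young gap of `u` is nonnegative with zero integral, so it vanishes a.e.; then `z ↦
  -- ψ z - ⟪u x, z⟫` attains its minimum at `g x`.
  have hzero : ∫ x, (ψ (g x) + denseConj ψ (u x) - inner ℝ (u x) (g x)) ∂μ = 0 := by
    have hsum : Integrable (fun x => ψ (g x) + denseConj ψ (u x)) μ := hint.add hu1
    rw [integral_sub hsum hu4, integral_add hint hu1, hu2]
    linarith
  have hnn : 0 ≤ᵐ[μ] fun x => ψ (g x) + denseConj ψ (u x) - inner ℝ (u x) (g x) := by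
    filter_upwards [hu3] with x hx
    have := hx (g x)
    rw [real_inner_comm] at this
    simpa using this
  rw [integral_eq_zero_iff_of_nonneg_ae hnn ((hint.add hu1).sub hu4)] at hzero
  filter_upwards [hzero, hu3, hdiff] with x hx hxle hxd
  simp only [Pi.zero_apply] at hx
  -- `z ↦ ψ z - ⟪u x, z⟫` is minimal at `g x`
  have hm : IsLocalMin (fun z => ψ z - inner ℝ (u x) z) (g x) :=
    Filter.Eventually.of_forall fun z => by
      have h1 := hxle z
      rw [real_inner_comm] at h1
      simp only
      linarith
  have hd := hxd.hasGradientAt.hasFDerivAt.sub (innerSL ℝ (u x)).hasFDerivAt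
  have h0 := hm.hasFDerivAt_eq_zero hd
  apply (InnerProductSpace.toDual ℝ (Vec d)).injective
  rw [sub_eq_zero] at h0
  rw [h0]
  rfl

end Transport

/-! ### Limits of dual potentials and derivatives of Lipschitz integrals -/

section Compactness

variable {d : ℕ} {X : Type*} [MeasurableSpace X] {μ : Measure X} {ν : Measure (Vec d)} {R : ℝ}

/-- Equi-Lipschitz functions on a separable space which agree at a point have a pointwise convergent
subsequence. -/
lemma exists_subseq_tendsto_of_lipschitz {E : Type*} [NormedAddCommGroup E]
    [TopologicalSpace.SeparableSpace E] {K : NNReal} {ψ : ℕ → E → ℝ}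
    (hψ : ∀ n, LipschitzWith K (ψ n)) (h0 : ∀ n, ψ n 0 = 0) :
    ∃ k : ℕ → ℕ, StrictMono k ∧ ∃ ψ' : E → ℝ, LipschitzWith K ψ' ∧
      ∀ x, Filter.Tendsto (fun n => ψ (k n) x) Filter.atTop (𝓝 (ψ' x)) := by
  let s := TopologicalSpace.denseSeq E
  -- Tychonoff on the values along a dense sequence replaces a diagonal argument.
  have hcpt : IsCompact (univ.pi fun i : ℕ => Icc (-(K * ‖s i‖)) (K * ‖s i‖)) :=
    isCompact_univ_pi fun i => isCompact_Icc
  have hmem : ∀ n, (fun i => ψ n (s i)) ∈ univ.pi fun i : ℕ => Icc (-(K * ‖s i‖)) (K * ‖s i‖) := by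
    intro n i _
    have := (hψ n).dist_le_mul (s i) 0
    rw [h0, dist_zero_right, dist_zero_right, Real.norm_eq_abs, abs_le] at this
    exact this
  obtain ⟨a, -, k, hk, hka⟩ := hcpt.tendsto_subseq hmem
  have hconv : ∀ x, CauchySeq fun n => ψ (k n) x := by
    intro x
    rw [Metric.cauchySeq_iff]
    intro ε hε
    obtain ⟨i, hi⟩ := (TopologicalSpace.denseRange_denseSeq E).exists_dist_lt x
      (show 0 < ε / (3 * (K + 1)) by positivity)
    have hi' : K * dist x (s i) ≤ ε / 3 := by
      calc K * dist x (s i) ≤ (K + 1) * (ε / (3 * (K + 1))) := by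
            gcongr
            linarith
        _ = ε / 3 := by field_simp
    have hc := ((tendsto_pi_nhds.1 hka) i).cauchySeq
    obtain ⟨N, hN⟩ := Metric.cauchySeq_iff.1 hc (ε / 3) (by positivity)
    refine ⟨N, fun m hm n hn => ?_⟩
    have h1 := hN m hm n hn
    have h2 := (hψ (k m)).dist_le_mul x (s i)
    have h3 := (hψ (k n)).dist_le_mul x (s i)
    have h4 := dist_triangle4 (ψ (k m) x) (ψ (k m) (s i)) (ψ (k n) (s i)) (ψ (k n) x)
    rw [dist_comm (ψ (k n) (s i))] at h4
    simp only [Function.comp] at h1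
    linarith
  choose ψ' hψ' using fun x => cauchySeq_tendsto_of_complete (hconv x)
  refine ⟨k, hk, ψ', LipschitzWith.of_dist_le_mul fun x y => ?_, hψ'⟩
  exact le_of_tendsto ((hψ' x).dist (hψ' y))
    (Filter.Eventually.of_forall fun n => (hψ (k n)).dist_le_mul x y)

/-- The normalization `ψ n 0 = 0` makes `χ n` nonnegative a.e. (take `x = 0` in the constraint), so
Fatou applies to the pointwise `liminf` of `χ n`, which inherits the constraint. -/
lemma DualPair.exists_limit {ψ χ : ℕ → Vec d → ℝ} {ψ' : Vec d → ℝ}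
    (h : ∀ n, DualPair ν R (ψ n) (χ n)) (h0 : ∀ n, ψ n 0 = 0)
    (hlip : LipschitzWith R.toNNReal ψ')
    (hψ' : ∀ x, Filter.Tendsto (fun n => ψ n x) Filter.atTop (𝓝 (ψ' x))) {a : ℝ}
    (ha : Filter.Tendsto (fun n => ∫ y, χ n y ∂ν) Filter.atTop (𝓝 a)) :
    ∃ χ', DualPair ν R ψ' χ' ∧ ∫ y, χ' y ∂ν ≤ a := by
  have hnn : ∀ n, 0 ≤ᵐ[ν] χ n := fun n => by
    filter_upwards [(h n).le] with y hy
    have := hy 0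
    rw [inner_zero_left, h0, zero_add] at this
    exact this
  have ha0 : 0 ≤ a := ge_of_tendsto ha (Filter.Eventually.of_forall fun n =>
    integral_nonneg_of_ae (hnn n))
  set L : Vec d → ℝ≥0∞ := fun y => Filter.liminf (fun n => ENNReal.ofReal (χ n y)) Filter.atTop
    with hL
  have hLm : AEMeasurable L ν := by
    simp only [hL, Filter.liminf_eq_iSup_iInf_of_nat]
    exact AEMeasurable.iSup fun n => AEMeasurable.iInf fun i => AEMeasurable.iInf fun _ =>
      (h i).integrable.aemeasurable.ennreal_ofReal
  have hLint : ∫⁻ y, L y ∂ν ≤ ENNReal.ofReal a := by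
    refine (lintegral_liminf_le' fun n => (h n).integrable.aemeasurable.ennreal_ofReal).trans ?_
    have : Filter.Tendsto (fun n => ∫⁻ y, ENNReal.ofReal (χ n y) ∂ν) Filter.atTop
        (𝓝 (ENNReal.ofReal a)) := by
      simp_rw [← ofReal_integral_eq_lintegral_ofReal (h _).integrable (hnn _)]
      exact (ENNReal.continuous_ofReal.tendsto a).comp ha
    exact this.liminf_eq.le
  have hLfin : ∫⁻ y, L y ∂ν ≠ ⊤ := (hLint.trans_lt ENNReal.ofReal_lt_top).ne
  refine ⟨fun y => (L y).toReal, ⟨hlip, integrable_toReal_of_lintegral_ne_top hLm hLfin, ?_⟩, ?_⟩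
  · filter_upwards [ae_lt_top' hLm hLfin, ae_all_iff.2 fun n => (h n).le] with y hy hle x
    have h1 : ENNReal.ofReal (inner ℝ x y - ψ' x) ≤ L y := by
      have h2 : Filter.Tendsto (fun n => ENNReal.ofReal (inner ℝ x y - ψ n x)) Filter.atTop
          (𝓝 (ENNReal.ofReal (inner ℝ x y - ψ' x))) :=
        (ENNReal.continuous_ofReal.tendsto _).comp (tendsto_const_nhds.sub (hψ' x))
      rw [← h2.liminf_eq]
      refine Filter.liminf_le_liminf (Filter.Eventually.of_forall fun n => ?_)
      exact ENNReal.ofReal_le_ofReal (by linarith [hle n x])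
    have h3 := (ENNReal.ofReal_le_iff_le_toReal hy.ne).1 h1
    linarith
  · rw [integral_toReal hLm (ae_lt_top' hLm hLfin)]
    exact ENNReal.toReal_le_of_le_ofReal ha0 hLint

/-- With the inner map frozen at `g'` this is dominated convergence; moving `g'` to `g n` costs at
most `K` times their `L^1` distance. -/
lemma tendsto_integral_comp_of_lipschitz [IsFiniteMeasure μ] {K : NNReal} {ψ : ℕ → Vec d → ℝ}
    {ψ' : Vec d → ℝ} (hψ : ∀ n, LipschitzWith K (ψ n)) (h0 : ∀ n, ψ n 0 = 0)
    (hψ' : ∀ x, Filter.Tendsto (fun n => ψ n x) Filter.atTop (𝓝 (ψ' x)))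
    {g : ℕ → X → Vec d} {g' : X → Vec d} (hg : ∀ n, Integrable (g n) μ) (hg' : Integrable g' μ)
    (hlim : Filter.Tendsto (fun n => ∫ x, ‖g n x - g' x‖ ∂μ) Filter.atTop (𝓝 0)) :
    Filter.Tendsto (fun n => ∫ x, ψ n (g n x) ∂μ) Filter.atTop (𝓝 (∫ x, ψ' (g' x) ∂μ)) := by
  have h1 : Filter.Tendsto (fun n => ∫ x, ψ n (g' x) ∂μ) Filter.atTop
      (𝓝 (∫ x, ψ' (g' x) ∂μ)) := by
    refine tendsto_integral_of_dominated_convergence (fun x => K * ‖g' x‖)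
      (fun n => (integrable_lipschitz_comp (hψ n) hg').1) (hg'.norm.const_mul _)
      (fun n => Filter.Eventually.of_forall fun x => ?_)
      (Filter.Eventually.of_forall fun x => hψ' _)
    have := (hψ n).dist_le_mul (g' x) 0
    rwa [h0, dist_zero_right, dist_zero_right] at this
  have h2 : Filter.Tendsto (fun n => ∫ x, ψ n (g n x) ∂μ - ∫ x, ψ n (g' x) ∂μ) Filter.atTop
      (𝓝 0) := by
    have h3 := hlim.const_mul (K : ℝ)
    rw [mul_zero] at h3
    refine squeeze_zero_norm (fun n => ?_) h3
    have hd := (hg n).sub hg'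
    rw [← integral_sub (integrable_lipschitz_comp (hψ n) (hg n))
      (integrable_lipschitz_comp (hψ n) hg'), ← integral_const_mul]
    refine norm_integral_le_of_norm_le (hd.norm.const_mul _)
      (Filter.Eventually.of_forall fun x => ?_)
    have := (hψ n).dist_le_mul (g n x) (g' x)
    rwa [dist_eq_norm, dist_eq_norm] at this
  simpa using h1.add h2

lemma tendsto_integral_lipschitz_diff_quotient [IsFiniteMeasure μ] {K : NNReal} {ψ : Vec d → ℝ}
    (hψ : LipschitzWith K ψ) {g h : X → Vec d} (hg : Integrable g μ) (hh : Integrable h μ)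
    (hdiff : ∀ᵐ x ∂μ, DifferentiableAt ℝ ψ (g x)) :
    Filter.Tendsto (fun t : ℝ => (∫ x, ψ (g x + t • h x) ∂μ - ∫ x, ψ (g x) ∂μ) / t) (𝓝[>] 0)
      (𝓝 (∫ x, inner ℝ (gradient ψ (g x)) (h x) ∂μ)) := by
  have hi := integrable_lipschitz_comp hψ hg
  have hit : ∀ t : ℝ, Integrable (fun x => ψ (g x + t • h x)) μ := fun t =>
    integrable_lipschitz_comp hψ (hg.add (hh.smul t))
  have h1 : Filter.Tendsto (fun t : ℝ => ∫ x, (ψ (g x + t • h x) - ψ (g x)) / t ∂μ) (𝓝[>] 0)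
      (𝓝 (∫ x, inner ℝ (gradient ψ (g x)) (h x) ∂μ)) := by
    refine tendsto_integral_filter_of_dominated_convergence (fun x => K * ‖h x‖)
      (Filter.Eventually.of_forall fun t => (((hit t).sub hi).div_const t).1) ?_
      (hh.norm.const_mul _) ?_
    · filter_upwards [self_mem_nhdsWithin] with t ht
      refine Filter.Eventually.of_forall fun x => ?_
      have ht : 0 < t := ht
      have := hψ.dist_le_mul (g x + t • h x) (g x)
      rw [dist_eq_norm, dist_eq_norm, add_sub_cancel_left, norm_smul, Real.norm_of_nonneg ht.le]
        at this
      rw [norm_div, Real.norm_of_nonneg ht.le, div_le_iff₀ ht]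
      linarith
    · filter_upwards [hdiff] with x hx
      have h2 := hx.hasGradientAt.hasFDerivAt.hasLineDerivAt (h x)
      have h3 := h2.tendsto_slope_zero_right
      refine h3.congr fun t => ?_
      rw [smul_eq_mul, div_eq_inv_mul]
  refine h1.congr fun t => ?_
  rw [integral_div, integral_sub (hit t) hi]

end Compactness

/-! ### The Legendre transform and its integral -/

section Legendre

variable {d : ℕ} {f : Mat d → ℝ}

lemma legendre_le_coe_iff {η : Mat d} {c : ℝ} :
    legendre f η ≤ (c : EReal) ↔ ∀ ξ, inner ℝ ξ η - f ξ ≤ c := by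
  simp only [legendre, iSup_le_iff, EReal.coe_le_coe_iff]

lemma coe_le_legendre (f : Mat d → ℝ) (ξ η : Mat d) :
    ((inner ℝ ξ η - f ξ : ℝ) : EReal) ≤ legendre f η :=
  le_iSup (fun ξ : Mat d => ((inner ℝ ξ η - f ξ : ℝ) : EReal)) ξ

lemma legendre_ne_bot (f : Mat d → ℝ) (η : Mat d) : legendre f η ≠ ⊥ :=
  ne_bot_of_le_ne_bot (EReal.coe_ne_bot _) (coe_le_legendre f 0 η)

lemma measurable_legendre (f : Mat d → ℝ) : Measurable (legendre f) := by
  refine LowerSemicontinuous.measurable (lowerSemicontinuous_iSup fun ξ => ?_)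
  refine Continuous.lowerSemicontinuous (continuous_coe_real_ereal.comp ?_)
  fun_prop

/-- The real value of the Legendre transform, meaningful where the latter is finite. -/
def legendreReal (f : Mat d → ℝ) (η : Mat d) : ℝ := (legendre f η).toReal

lemma coe_legendreReal {η : Mat d} (h : legendre f η ≠ ⊤) :
    (legendreReal f η : EReal) = legendre f η :=
  EReal.coe_toReal h (legendre_ne_bot f η)

lemma measurable_legendreReal (f : Mat d → ℝ) : Measurable (legendreReal f) :=
  (measurable_legendre f).ereal_toReal

lemma inner_sub_le_legendreReal {η : Mat d} (h : legendre f η ≠ ⊤) (ξ : Mat d) :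
    inner ℝ ξ η - f ξ ≤ legendreReal f η := by
  rw [← EReal.coe_le_coe_iff, coe_legendreReal h]
  exact coe_le_legendre f ξ η

lemma neg_le_legendreReal {η : Mat d} (h : legendre f η ≠ ⊤) : -f 0 ≤ legendreReal f η := by
  have := inner_sub_le_legendreReal h 0
  rwa [inner_zero_left, zero_sub] at this

lemma legendre_ne_top_of_le {η : Mat d} {c : ℝ} (h : ∀ ξ, inner ℝ ξ η - f ξ ≤ c) :
    legendre f η ≠ ⊤ :=
  ne_top_of_le_ne_top (EReal.coe_ne_top c) (legendre_le_coe_iff.2 h)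

lemma legendreReal_le {η : Mat d} {c : ℝ} (h : ∀ ξ, inner ℝ ξ η - f ξ ≤ c) :
    legendreReal f η ≤ c := by
  rw [← EReal.coe_le_coe_iff, coe_legendreReal (legendre_ne_top_of_le h)]
  exact legendre_le_coe_iff.2 h

/-- The Legendre transform of a locally bounded function is superlinear. -/
lemma mul_norm_sub_le_legendreReal {M C : ℝ} (hM : 0 ≤ M) (hC : ∀ ξ, ‖ξ‖ ≤ M → f ξ ≤ C)
    {η : Mat d} (h : legendre f η ≠ ⊤) : M * ‖η‖ - C ≤ legendreReal f η := by
  -- Test with the vector of length `M` in the direction of `η`; for `η = 0` the convention `M / 0 =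
  -- 0` makes it the zero vector.
  have h1 := inner_sub_le_legendreReal h ((M / ‖η‖) • η)
  rw [real_inner_smul_left, real_inner_self_eq_norm_sq] at h1
  have h2 : ‖(M / ‖η‖) • η‖ ≤ M := by
    rw [norm_smul, norm_div, norm_norm, Real.norm_of_nonneg hM]
    rcases eq_or_ne ‖η‖ 0 with h0 | h0
    · simpa [h0] using hM
    · rw [div_mul_cancel₀ _ h0]
  have h3 : M / ‖η‖ * ‖η‖ ^ 2 = M * ‖η‖ := by
    rcases eq_or_ne ‖η‖ 0 with h0 | h0
    · simp [h0]
    · field_simp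
  linarith [hC _ h2]

section Integral

variable {X : Type*} [MeasurableSpace X] {μ : Measure X}

/-- `f^*(φ)` is finite almost everywhere and integrable. -/
def HasFiniteEnergy (f : Mat d → ℝ) (μ : Measure X) (φ : X → Mat d) : Prop :=
  (∀ᵐ x ∂μ, legendre f (φ x) ≠ ⊤) ∧ Integrable (fun x => legendreReal f (φ x)) μ

variable [IsFiniteMeasure μ]

/-- The lower bound `-f 0` is automatic, so an integrable upper bound suffices. Bounding each affine
function separately yields both convexity and lower semicontinuity of the energy. -/
lemma HasFiniteEnergy.of_le {φ : X → Mat d} (hφ : AEMeasurable φ μ) {c : X → ℝ}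
    (hc : Integrable c μ) (h : ∀ᵐ x ∂μ, ∀ ξ, inner ℝ ξ (φ x) - f ξ ≤ c x) :
    HasFiniteEnergy f μ φ ∧ ∫ x, legendreReal f (φ x) ∂μ ≤ ∫ x, c x ∂μ := by
  have h1 : ∀ᵐ x ∂μ, legendre f (φ x) ≠ ⊤ := h.mono fun x hx => legendre_ne_top_of_le hx
  have h2 : Integrable (fun x => legendreReal f (φ x)) μ := by
    refine Integrable.mono' (hc.norm.add (integrable_const |f 0|))
      ((measurable_legendreReal f).comp_aemeasurable hφ).aestronglyMeasurable ?_
    filter_upwards [h, h1] with x hx hx1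
    simp only [Real.norm_eq_abs, Pi.add_apply]
    rw [abs_le]
    constructor
    · linarith [neg_le_legendreReal hx1, le_abs_self (f 0), abs_nonneg (c x)]
    · linarith [legendreReal_le hx, abs_nonneg (f 0), le_abs_self (c x)]
  exact ⟨⟨h1, h2⟩, integral_mono_ae h2 hc (h.mono fun x hx => legendreReal_le hx)⟩

lemma HasFiniteEnergy.convex_comb {φ₀ φ₁ φ : X → Mat d} (h₀ : HasFiniteEnergy f μ φ₀)
    (h₁ : HasFiniteEnergy f μ φ₁) (hφ : AEMeasurable φ μ) {t : ℝ} (ht0 : 0 ≤ t) (ht1 : t ≤ 1)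
    (h : ∀ᵐ x ∂μ, φ x = (1 - t) • φ₀ x + t • φ₁ x) :
    HasFiniteEnergy f μ φ ∧ ∫ x, legendreReal f (φ x) ∂μ ≤
      (1 - t) * ∫ x, legendreReal f (φ₀ x) ∂μ + t * ∫ x, legendreReal f (φ₁ x) ∂μ := by
  have := HasFiniteEnergy.of_le (f := f) hφ
    ((h₀.2.const_mul (1 - t)).add (h₁.2.const_mul t)) (by
      filter_upwards [h, h₀.1, h₁.1] with x hx hx0 hx1 ξ
      rw [hx, inner_add_right, inner_smul_right, inner_smul_right]
      have e0 := mul_le_mul_of_nonneg_left (inner_sub_le_legendreReal hx0 ξ) (sub_nonneg.2 ht1)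
      have e1 := mul_le_mul_of_nonneg_left (inner_sub_le_legendreReal hx1 ξ) ht0
      simp only [Pi.add_apply]
      linarith)
  refine ⟨this.1, this.2.trans_eq ?_⟩
  simp only [Pi.add_apply]
  rw [integral_add (h₀.2.const_mul _) (h₁.2.const_mul _), integral_const_mul, integral_const_mul]

/-- Lower semicontinuity of `φ ↦ ∫ f^*(φ)`. -/
lemma HasFiniteEnergy.of_tendsto {φ : ℕ → X → Mat d} {φ' : X → Mat d}
    (hφ : ∀ n, HasFiniteEnergy f μ (φ n)) (hm : AEMeasurable φ' μ)
    (hlim : ∀ᵐ x ∂μ, Filter.Tendsto (fun n => φ n x) Filter.atTop (𝓝 (φ' x))) {e : ℝ}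
    (he : Filter.Tendsto (fun n => ∫ x, legendreReal f (φ n x) ∂μ) Filter.atTop (𝓝 e)) :
    HasFiniteEnergy f μ φ' ∧ ∫ x, legendreReal f (φ' x) ∂μ ≤ e := by
  -- Adding `f 0` makes the integrands nonnegative a.e., as Fatou requires.
  have hint : ∀ n, Integrable (fun x => legendreReal f (φ n x) + f 0) μ := fun n =>
    (hφ n).2.add (integrable_const _)
  have hnn : ∀ n, 0 ≤ᵐ[μ] fun x => legendreReal f (φ n x) + f 0 := fun n => by
    filter_upwards [(hφ n).1] with x hx
    have := neg_le_legendreReal hx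
    simp only [Pi.zero_apply]
    linarith
  set m : ℝ := ∫ _, f 0 ∂μ with hmdef
  have hlim' : Filter.Tendsto (fun n => ∫ x, (legendreReal f (φ n x) + f 0) ∂μ) Filter.atTop
      (𝓝 (e + m)) := by
    refine (he.add_const m).congr fun n => ?_
    rw [integral_add (hφ n).2 (integrable_const _)]
  have ha0 : 0 ≤ e + m := ge_of_tendsto hlim' (Filter.Eventually.of_forall fun n =>
    integral_nonneg_of_ae (hnn n))
  set L : X → ℝ≥0∞ := fun x =>
    Filter.liminf (fun n => ENNReal.ofReal (legendreReal f (φ n x) + f 0)) Filter.atTop with hL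
  have hLm : AEMeasurable L μ := by
    simp only [hL, Filter.liminf_eq_iSup_iInf_of_nat]
    exact AEMeasurable.iSup fun n => AEMeasurable.iInf fun i => AEMeasurable.iInf fun _ =>
      (hint i).aemeasurable.ennreal_ofReal
  have hLint : ∫⁻ x, L x ∂μ ≤ ENNReal.ofReal (e + m) := by
    refine (lintegral_liminf_le' fun n => (hint n).aemeasurable.ennreal_ofReal).trans ?_
    have : Filter.Tendsto (fun n => ∫⁻ x, ENNReal.ofReal (legendreReal f (φ n x) + f 0) ∂μ)
        Filter.atTop (𝓝 (ENNReal.ofReal (e + m))) := by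
      simp_rw [← ofReal_integral_eq_lintegral_ofReal (hint _) (hnn _)]
      exact (ENNReal.continuous_ofReal.tendsto _).comp hlim'
    exact this.liminf_eq.le
  have hLfin : ∫⁻ x, L x ∂μ ≠ ⊤ := (hLint.trans_lt ENNReal.ofReal_lt_top).ne
  have hLi := integrable_toReal_of_lintegral_ne_top hLm hLfin
  have := HasFiniteEnergy.of_le (f := f) (c := fun x => (L x).toReal - f 0) hm
    (hLi.sub (integrable_const _)) (by
      filter_upwards [ae_lt_top' hLm hLfin, hlim, ae_all_iff.2 fun n => (hφ n).1]
        with x hy hx hle ξ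
      have h1 : ENNReal.ofReal (inner ℝ ξ (φ' x) - f ξ + f 0) ≤ L x := by
        have h2 : Filter.Tendsto (fun n => ENNReal.ofReal (inner ℝ ξ (φ n x) - f ξ + f 0))
            Filter.atTop (𝓝 (ENNReal.ofReal (inner ℝ ξ (φ' x) - f ξ + f 0))) :=
          (ENNReal.continuous_ofReal.tendsto _).comp
            (((tendsto_const_nhds.inner hx).sub_const _).add_const _)
        rw [← h2.liminf_eq]
        refine Filter.liminf_le_liminf (Filter.Eventually.of_forall fun n => ?_)
        exact ENNReal.ofReal_le_ofReal (by linarith [inner_sub_le_legendreReal (hle n) ξ])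
      have h3 := (ENNReal.ofReal_le_iff_le_toReal hy.ne).1 h1
      linarith)
  refine ⟨this.1, this.2.trans ?_⟩
  rw [integral_sub hLi (integrable_const _), integral_toReal hLm (ae_lt_top' hLm hLfin)]
  have := ENNReal.toReal_le_of_le_ofReal ha0 hLint
  linarith

end Integral

section ExtIntegral

variable {Ω : Set (Vec d)} [IsFiniteMeasure (volume.restrict Ω)] {φ : Vec d → Mat d}

/-- Since `f^* ≥ -f 0` and the domain has finite measure, `extIntegral` never meets `∞ - ∞` here. -/
lemma lintegral_neg_legendre_ne_top (f : Mat d → ℝ) (φ : Vec d → Mat d) :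
    ∫⁻ x in Ω, (-legendre f (φ x)).toENNReal ≠ ⊤ := by
  refine ne_top_of_le_ne_top (b := ∫⁻ _ in Ω, ENNReal.ofReal (f 0)) ?_ ?_
  · rw [lintegral_const]
    exact ENNReal.mul_ne_top ENNReal.ofReal_ne_top (measure_ne_top _ _)
  · refine lintegral_mono fun x => ?_
    rw [← EReal.real_coe_toENNReal]
    refine EReal.toENNReal_le_toENNReal ?_
    have := coe_le_legendre f 0 (φ x)
    rw [inner_zero_left, zero_sub, EReal.coe_neg] at this
    exact EReal.neg_le_of_neg_le this

omit [IsFiniteMeasure (volume.restrict Ω)] in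
lemma HasFiniteEnergy.extIntegral_eq (h : HasFiniteEnergy f (volume.restrict Ω) φ) :
    extIntegral Ω (fun x => legendre f (φ x)) = ((∫ x in Ω, legendreReal f (φ x) : ℝ) : EReal) := by
  have e1 : ∫⁻ x in Ω, (legendre f (φ x)).toENNReal =
      ∫⁻ x in Ω, ENNReal.ofReal (legendreReal f (φ x)) :=
    lintegral_congr_ae (h.1.mono fun x hx => EReal.toENNReal_of_ne_top hx)
  have e2 : ∫⁻ x in Ω, (-legendre f (φ x)).toENNReal =
      ∫⁻ x in Ω, ENNReal.ofReal (-legendreReal f (φ x)) :=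
    lintegral_congr_ae (h.1.mono fun x hx => by
      simp only
      rw [← coe_legendreReal hx, ← EReal.coe_neg, EReal.real_coe_toENNReal])
  have n1 : ∫⁻ x in Ω, ENNReal.ofReal (legendreReal f (φ x)) ≠ ⊤ := h.2.lintegral_lt_top.ne
  have n2 : ∫⁻ x in Ω, ENNReal.ofReal (-legendreReal f (φ x)) ≠ ⊤ := h.2.neg.lintegral_lt_top.ne
  rw [integral_eq_lintegral_pos_part_sub_lintegral_neg_part h.2, extIntegral, e1, e2,
    EReal.coe_sub, EReal.coe_ennreal_toReal n1, EReal.coe_ennreal_toReal n2]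

lemma hasFiniteEnergy_of_extIntegral_ne_top (hφ : AEMeasurable φ (volume.restrict Ω))
    (h : extIntegral Ω (fun x => legendre f (φ x)) ≠ ⊤) :
    HasFiniteEnergy f (volume.restrict Ω) φ := by
  have hp : ∫⁻ x in Ω, (legendre f (φ x)).toENNReal ≠ ⊤ := by
    intro h1
    apply h
    rw [extIntegral, h1, ← EReal.coe_ennreal_toReal (lintegral_neg_legendre_ne_top f φ),
      EReal.coe_ennreal_top, EReal.top_sub_coe]
  have hm : AEMeasurable (fun x => (legendre f (φ x)).toENNReal) (volume.restrict Ω) :=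
    ((measurable_legendre f).comp_aemeasurable hφ).ereal_toENNReal
  refine (HasFiniteEnergy.of_le hφ (integrable_toReal_of_lintegral_ne_top hm hp) ?_).1
  filter_upwards [ae_lt_top' hm hp] with x hx ξ
  have h1 : legendre f (φ x) ≠ ⊤ := EReal.toENNReal_ne_top_iff.1 hx.ne
  refine (inner_sub_le_legendreReal h1 ξ).trans ?_
  rw [EReal.toENNReal_of_ne_top h1, legendreReal, ENNReal.toReal_ofReal']
  exact le_max_left _ _

end ExtIntegral

end Legendre

/-! ### Fields and divergences as linear maps into `L^1` -/

section SobolevMaps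

/-- The inclusion `L^p → L^1` for a finite measure. -/
def lpToL1 {X V : Type*} [MeasurableSpace X] (μ : Measure X) [IsFiniteMeasure μ]
    [NormedAddCommGroup V] [NormedSpace ℝ V] (p : ℝ≥0∞) [hp : Fact (1 ≤ p)] :
    Lp V p μ →ₗ[ℝ] Lp V 1 μ where
  toFun g := ((Lp.memLp g).mono_exponent hp.out).toLp g
  map_add' g h := by
    rw [← MemLp.toLp_add]
    exact MemLp.toLp_congr _ (((Lp.memLp g).mono_exponent hp.out).add
      ((Lp.memLp h).mono_exponent hp.out)) (Lp.coeFn_add g h)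
  map_smul' c g := by
    rw [RingHom.id_apply, ← MemLp.toLp_const_smul]
    exact MemLp.toLp_congr _ (((Lp.memLp g).mono_exponent hp.out).const_smul c)
      (Lp.coeFn_smul c g)

lemma coeFn_lpToL1 {X V : Type*} [MeasurableSpace X] (μ : Measure X) [IsFiniteMeasure μ]
    [NormedAddCommGroup V] [NormedSpace ℝ V] (p : ℝ≥0∞) [hp : Fact (1 ≤ p)] (g : Lp V p μ) :
    lpToL1 μ p g =ᵐ[μ] g :=
  MemLp.coeFn_toLp ((Lp.memLp g).mono_exponent hp.out)

/-- `rowTrace` as a continuous linear map. -/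
def rowTraceL (d : ℕ) : MatGrad d →L[ℝ] Vec d :=
  LinearMap.toContinuousLinearMap
    { toFun := rowTrace
      map_add' := fun A B => by
        ext i
        simp [rowTrace, Finset.sum_add_distrib]
      map_smul' := fun c A => by
        ext i
        simp [rowTrace, Finset.mul_sum] }

variable {d : ℕ} {Ω : Set (Vec d)} {q : ℝ} [Fact (1 < q)]

/-- The field of a Sobolev element, as a linear map. -/
def fldMap (Ω : Set (Vec d)) (q : ℝ) [Fact (1 < q)] :
    sobolevZero Ω q →ₗ[ℝ] Lp (Mat d) (ENNReal.ofReal q) (volume.restrict Ω) :=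
  LinearMap.fst ℝ _ _ ∘ₗ (sobolevZero Ω q).subtype

/-- A Sobolev element is determined by its field: weak gradients are unique. -/
lemma fldMap_injective (hΩ : IsOpen Ω) : Function.Injective (fldMap Ω q) := by
  rw [← LinearMap.ker_eq_bot, LinearMap.ker_eq_bot']
  intro φ hφ
  have hfld : fld φ = 0 := hφ
  have hw : IsWeakGrad Ω (fld φ) (grd φ) := φ.2.1
  have hq : (1 : ℝ≥0∞) ≤ ENNReal.ofReal q := Fact.out
  -- For a zero field the weak gradient integrates to zero against every test function, so the
  -- fundamental lemma of the calculus of variations applies in each direction; a basis gives one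
  -- common null set.
  have hv : ∀ v : Vec d, ∀ᵐ x ∂volume.restrict Ω, grd φ x v = 0 := by
    intro v
    rw [ae_restrict_iff' hΩ.measurableSet]
    refine IsOpen.ae_eq_zero_of_integral_contDiff_smul_eq_zero hΩ ?_ fun g hg hgc hgs => ?_
    · refine locallyIntegrableOn_of_locallyIntegrable_restrict ?_
      have := (((Lp.memLp (grd φ)).continuousLinearMap_comp
        (ContinuousLinearMap.apply ℝ (Mat d) v)).locallyIntegrable hq)
      exact this
    · have h1 := hw g ⟨hg, hgc, hgs⟩ v
      have h2 : ∫ x in Ω, (fderiv ℝ g x v) • fld φ x = 0 := by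
        apply integral_eq_zero_of_ae
        rw [hfld]
        filter_upwards [Lp.coeFn_zero (Mat d) (ENNReal.ofReal q) (volume.restrict Ω)] with x hx
        simp only [hx, Pi.zero_apply, smul_zero]
      rw [h2, eq_comm, neg_eq_zero] at h1
      rw [← h1, setIntegral_eq_integral_of_forall_compl_eq_zero]
      intro x hx
      rw [image_eq_zero_of_notMem_tsupport fun h => hx (hgs h), zero_smul]
  have hgrd : grd φ = 0 := by
    rw [Lp.eq_zero_iff_ae_eq_zero]
    have hall : ∀ᵐ x ∂volume.restrict Ω, ∀ i : Fin d,
        grd φ x (EuclideanSpace.basisFun (Fin d) ℝ i) = 0 := ae_all_iff.2 fun i => hv _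
    filter_upwards [hall] with x hx
    have : ((grd φ x : MatGrad d) : Vec d →ₗ[ℝ] Mat d) = 0 :=
      (EuclideanSpace.basisFun (Fin d) ℝ).toBasis.ext fun i => by simpa using hx i
    ext1 v
    exact LinearMap.congr_fun this v
  exact Subtype.ext (Prod.ext hfld hgrd)

variable [IsFiniteMeasure (volume.restrict Ω)]

/-- The field of a Sobolev element in `L^1`. -/
def fldL1 (Ω : Set (Vec d)) (q : ℝ) [Fact (1 < q)] [IsFiniteMeasure (volume.restrict Ω)] :
    sobolevZero Ω q →ₗ[ℝ] Lp (Mat d) 1 (volume.restrict Ω) :=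
  lpToL1 _ _ ∘ₗ fldMap Ω q

/-- The divergence of a Sobolev element in `L^1`. -/
def divL1 (Ω : Set (Vec d)) (q : ℝ) [Fact (1 < q)] [IsFiniteMeasure (volume.restrict Ω)] :
    sobolevZero Ω q →ₗ[ℝ] Lp (Vec d) 1 (volume.restrict Ω) :=
  lpToL1 _ _ ∘ₗ ((rowTraceL d).compLpL (ENNReal.ofReal q) (volume.restrict Ω)).toLinearMap ∘ₗ
    LinearMap.snd ℝ _ _ ∘ₗ (sobolevZero Ω q).subtype

lemma coeFn_fldL1 (φ : sobolevZero Ω q) : fldL1 Ω q φ =ᵐ[volume.restrict Ω] fld φ :=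
  coeFn_lpToL1 _ _ _

lemma coeFn_divL1 (φ : sobolevZero Ω q) : divL1 Ω q φ =ᵐ[volume.restrict Ω] divg φ :=
  (coeFn_lpToL1 _ _ _).trans ((rowTraceL d).coeFn_compLpL (grd φ))

/-- Injectivity makes the `L^1` norm of the field, which the energy controls, comparable to the
Sobolev norm on the span of `S`. -/
lemma fldL1_injective (hΩ : IsOpen Ω) : Function.Injective (fldL1 Ω q) := by
  intro φ φ' h
  apply fldMap_injective hΩ
  refine Lp.ext ?_
  have h1 := coeFn_fldL1 φ
  rw [h] at h1
  exact h1.symm.trans (coeFn_fldL1 φ')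

lemma integrable_divg (φ : sobolevZero Ω q) : IntegrableOn (divg φ) Ω :=
  (L1.integrable_coeFn (divL1 Ω q φ)).congr (coeFn_divL1 φ)

lemma integral_norm_divg (φ : sobolevZero Ω q) : ∫ x in Ω, ‖divg φ x‖ = ‖divL1 Ω q φ‖ := by
  rw [L1.norm_eq_integral_norm]
  exact integral_congr_ae ((coeFn_divL1 φ).symm.fun_comp norm)

lemma integral_norm_fld (φ : sobolevZero Ω q) : ∫ x in Ω, ‖fld φ x‖ = ‖fldL1 Ω q φ‖ := by
  rw [L1.norm_eq_integral_norm]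
  exact integral_congr_ae ((coeFn_fldL1 φ).symm.fun_comp norm)

lemma divg_add (φ φ' : sobolevZero Ω q) :
    divg (φ + φ') =ᵐ[volume.restrict Ω] fun x => divg φ x + divg φ' x := by
  filter_upwards [coeFn_divL1 (φ + φ'), coeFn_divL1 φ, coeFn_divL1 φ',
    Lp.coeFn_add (divL1 Ω q φ) (divL1 Ω q φ')] with x h1 h2 h3 h4
  rw [← h1, map_add, h4, Pi.add_apply, h2, h3]

lemma divg_smul (c : ℝ) (φ : sobolevZero Ω q) :
    divg (c • φ) =ᵐ[volume.restrict Ω] fun x => c • divg φ x := by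
  filter_upwards [coeFn_divL1 (c • φ), coeFn_divL1 φ,
    Lp.coeFn_smul c (divL1 Ω q φ)] with x h1 h2 h3
  rw [← h1, map_smul, h3, Pi.smul_apply, h2]

lemma divg_sub (φ φ' : sobolevZero Ω q) :
    divg (φ - φ') =ᵐ[volume.restrict Ω] fun x => divg φ x - divg φ' x := by
  filter_upwards [coeFn_divL1 (φ - φ'), coeFn_divL1 φ, coeFn_divL1 φ',
    Lp.coeFn_sub (divL1 Ω q φ) (divL1 Ω q φ')] with x h1 h2 h3 h4
  rw [← h1, map_sub, h4, Pi.sub_apply, h2, h3]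

end SobolevMaps

/-! ### Linear maps and compactness on a finite dimensional subspace -/

section FiniteDimensional

variable {V W : Type*} [NormedAddCommGroup V] [NormedSpace ℝ V] [NormedAddCommGroup W]
  [NormedSpace ℝ W] (K : Submodule ℝ V) [FiniteDimensional ℝ K] (T : V →ₗ[ℝ] W)

lemma exists_norm_map_le_of_finiteDimensional : ∃ C : ℝ, 0 ≤ C ∧ ∀ φ ∈ K, ‖T φ‖ ≤ C * ‖φ‖ := by
  let T' := LinearMap.toContinuousLinearMap (T ∘ₗ K.subtype)
  exact ⟨‖T'‖, norm_nonneg T', fun φ hφ => T'.le_opNorm ⟨φ, hφ⟩⟩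

variable {T} in
lemma exists_norm_le_map_of_injective (hT : Function.Injective T) :
    ∃ C : ℝ, 0 ≤ C ∧ ∀ φ ∈ K, ‖φ‖ ≤ C * ‖T φ‖ := by
  have hinj : Function.Injective (T ∘ₗ K.subtype) := hT.comp K.injective_subtype
  obtain ⟨C, -, hC⟩ := (T ∘ₗ K.subtype).exists_antilipschitzWith (LinearMap.ker_eq_bot.2 hinj)
  refine ⟨C, C.2, fun φ hφ => ?_⟩
  have := hC.le_mul_dist ⟨φ, hφ⟩ 0
  rw [dist_zero_right, map_zero, dist_zero_right] at this
  exact this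

lemma tendsto_map_of_finiteDimensional {φ : ℕ → K} {φ' : K}
    (h : Filter.Tendsto φ Filter.atTop (𝓝 φ')) :
    Filter.Tendsto (fun n => T (φ n)) Filter.atTop (𝓝 (T φ')) :=
  have hcont : Continuous (T ∘ₗ K.subtype) := LinearMap.continuous_of_finiteDimensional _
  (hcont.tendsto φ').comp h

lemma exists_subseq_tendsto_of_norm_le {φ : ℕ → K} {B : ℝ} (h : ∀ n, ‖(φ n : V)‖ ≤ B) :
    ∃ (φ' : K) (k : ℕ → ℕ), StrictMono k ∧ Filter.Tendsto (φ ∘ k) Filter.atTop (𝓝 φ') := by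
  have : ProperSpace K := FiniteDimensional.proper ℝ K
  obtain ⟨φ', -, k, hk, hkφ⟩ := tendsto_subseq_of_bounded
    (Metric.isBounded_closedBall (x := (0 : K)) (r := B)) (x := φ)
    fun n => mem_closedBall_zero_iff.2 (h n)
  exact ⟨φ', k, hk, hkφ⟩

end FiniteDimensional

/-! ### Existence of a minimizer of the joint dual problem -/

section Minimization

variable {d : ℕ} {Ω : Set (Vec d)} {q : ℝ} [Fact (1 < q)] {f : Mat d → ℝ} {F : Vec d → Vec d}
  {S : Set (sobolevZero Ω q)} {ν : Measure (Vec d)} {R : ℝ}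

/-- Admissible triples for the joint dual problem. -/
structure Feasible (f : Mat d → ℝ) (S : Set (sobolevZero Ω q)) (ν : Measure (Vec d)) (R : ℝ)
    (φ : sobolevZero Ω q) (ψ χ : Vec d → ℝ) : Prop where
  mem : φ ∈ S
  energy : HasFiniteEnergy f (volume.restrict Ω) (fld φ)
  dual : DualPair ν R ψ χ

/-- The value of the joint dual problem. -/
def dualValue (f : Mat d → ℝ) (F : Vec d → Vec d) (ν : Measure (Vec d))
    (φ : sobolevZero Ω q) (ψ χ : Vec d → ℝ) : ℝ :=
  (∫ x in Ω, legendreReal f (fld φ x)) + (∫ x in Ω, ψ (divg φ x + F x)) + ∫ y, χ y ∂ν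

variable [IsFiniteMeasure (volume.restrict Ω)] [IsFiniteMeasure ν]

lemma integrable_divg_add (hF : IntegrableOn F Ω) (φ : sobolevZero Ω q) :
    Integrable (fun x => divg φ x + F x) (volume.restrict Ω) :=
  (integrable_divg φ).add hF

/-- Adding opposite constants to the two potentials does not change the value. -/
lemma Feasible.normalize (hmass : (volume.restrict Ω) univ = ν univ) (hF : IntegrableOn F Ω)
    {φ : sobolevZero Ω q} {ψ χ : Vec d → ℝ} (h : Feasible f S ν R φ ψ χ) :
    Feasible f S ν R φ (fun x => ψ x - ψ 0) (fun y => χ y + ψ 0) ∧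
      dualValue f F ν φ (fun x => ψ x - ψ 0) (fun y => χ y + ψ 0) = dualValue f F ν φ ψ χ := by
  refine ⟨⟨h.mem, h.energy, ⟨?_, h.dual.integrable.add (integrable_const _), ?_⟩⟩, ?_⟩
  · refine LipschitzWith.of_dist_le_mul fun x y => ?_
    rw [dist_sub_right]
    exact h.dual.lipschitz.dist_le_mul x y
  · filter_upwards [h.dual.le] with y hy x
    linarith [hy x]
  -- The two constants cancel because `Ω` and the target have equal mass.
  · have hm : (volume.restrict Ω).real univ = ν.real univ := by simp only [Measure.real, hmass]
    simp only [dualValue]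
    rw [integral_sub (integrable_lipschitz_comp h.dual.lipschitz
      (integrable_divg_add hF φ)) (integrable_const _),
      integral_add h.dual.integrable (integrable_const _), integral_const, integral_const, hm]
    ring

lemma neg_le_integral_lipschitz_comp (hF : IntegrableOn F Ω) (hR : 0 ≤ R) {ψ : Vec d → ℝ}
    (hψ : LipschitzWith R.toNNReal ψ) (h0 : ψ 0 = 0) (φ : sobolevZero Ω q) :
    -(R * (‖divL1 Ω q φ‖ + ∫ x in Ω, ‖F x‖)) ≤ ∫ x in Ω, ψ (divg φ x + F x) := by
  rw [← integral_norm_divg, ← integral_add (integrable_divg φ).norm hF.norm, ← integral_const_mul,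
    ← integral_neg]
  refine integral_mono (((integrable_divg φ).norm.add hF.norm).const_mul R).neg
    (integrable_lipschitz_comp hψ (integrable_divg_add hF φ)) fun x => ?_
  have h1 := hψ.dist_le_mul (divg φ x + F x) 0
  rw [h0, dist_zero_right, dist_zero_right, Real.coe_toNNReal _ hR, Real.norm_eq_abs] at h1
  have h2 := mul_le_mul_of_nonneg_left (norm_add_le (divg φ x) (F x)) hR
  simp only
  linarith [neg_le_of_abs_le h1]

lemma mul_norm_fldL1_sub_le_energy {M C : ℝ} (hM : 0 ≤ M) (hC : ∀ ξ, ‖ξ‖ ≤ M → f ξ ≤ C)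
    {φ : sobolevZero Ω q} (h : HasFiniteEnergy f (volume.restrict Ω) (fld φ)) :
    M * ‖fldL1 Ω q φ‖ - (∫ _ in Ω, C) ≤ ∫ x in Ω, legendreReal f (fld φ x) := by
  have hi : Integrable (fun x => ‖fld φ x‖) (volume.restrict Ω) :=
    ((L1.integrable_coeFn (fldL1 Ω q φ)).congr (coeFn_fldL1 φ)).norm
  rw [← integral_norm_fld, ← integral_const_mul, ← integral_sub (hi.const_mul M)
    (integrable_const _)]
  exact integral_mono_ae ((hi.const_mul M).sub (integrable_const _)) h.2
    (h.1.mono fun x hx => mul_norm_sub_le_legendreReal hM hC hx)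

omit [IsFiniteMeasure ν] in
lemma DualPair.integral_nonneg {ψ χ : Vec d → ℝ} (h : DualPair ν R ψ χ) (h0 : ψ 0 = 0) :
    0 ≤ ∫ y, χ y ∂ν := by
  refine integral_nonneg_of_ae ?_
  filter_upwards [h.le] with y hy
  have := hy 0
  rw [inner_zero_left, h0, zero_add] at this
  exact this

-- The direct method. Fields converge in the span, potentials pointwise, and energies along a
-- further subsequence; the `χ`-integrals then converge as a difference, and each term is lower
-- semicontinuous.
set_option maxHeartbeats 1000000 in
theorem exists_feasible_minimizer (hΩ : IsOpen Ω) (hmass : (volume.restrict Ω) univ = ν univ)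
    (hF : IntegrableOn F Ω) (hR : 0 ≤ R) (hνR : ∀ᵐ y ∂ν, ‖y‖ ≤ R)
    (hf : ∀ M : ℝ, ∃ C, ∀ ξ, ‖ξ‖ ≤ M → f ξ ≤ C)
    [FiniteDimensional ℝ (Submodule.span ℝ S)] (hScl : IsClosed S)
    (hne : ∃ φ ∈ S, HasFiniteEnergy f (volume.restrict Ω) (fld φ)) :
    ∃ φ ψ χ, Feasible f S ν R φ ψ χ ∧ ∀ φ' ψ' χ', Feasible f S ν R φ' ψ' χ' →
      dualValue f F ν φ ψ χ ≤ dualValue f F ν φ' ψ' χ' := by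
  set K := Submodule.span ℝ S with hK
  have hSK : S ⊆ K := Submodule.subset_span
  obtain ⟨Cd, hCd0, hCd⟩ := exists_norm_map_le_of_finiteDimensional K (divL1 Ω q)
  obtain ⟨Cf, hCf0, hCf⟩ := exists_norm_le_map_of_injective K (fldL1_injective (q := q) hΩ)
  have hM0 : 0 ≤ (R * Cd + 1) * Cf := by positivity
  -- This slope for the superlinear bound beats the loss `R * Cd * ‖φ‖` from the `ψ`-term and leaves
  -- a full `‖φ‖` of coercivity.
  obtain ⟨C, hC⟩ := hf ((R * Cd + 1) * Cf)
  -- coercivity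
  have hE : ∀ φ ψ χ, Feasible f S ν R φ ψ χ →
      (R * Cd + 1) * ‖φ‖ - (∫ _ in Ω, C) ≤ ∫ x in Ω, legendreReal f (fld φ x) := by
    intro φ ψ χ h
    refine le_trans ?_ (mul_norm_fldL1_sub_le_energy hM0 hC h.energy)
    have := mul_le_mul_of_nonneg_left (hCf φ (hSK h.mem)) (show 0 ≤ R * Cd + 1 by positivity)
    linarith
  set B₀ : ℝ := (∫ _ in Ω, C) + R * ∫ x in Ω, ‖F x‖ with hB₀
  have hA : ∀ φ ψ χ, Feasible f S ν R φ ψ χ → ψ 0 = 0 →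
      -(R * Cd * ‖φ‖) - R * ∫ x in Ω, ‖F x‖ ≤ ∫ x in Ω, ψ (divg φ x + F x) := by
    intro φ ψ χ h h0
    refine le_trans ?_ (neg_le_integral_lipschitz_comp hF hR h.dual.lipschitz h0 φ)
    have := mul_le_mul_of_nonneg_left (hCd φ (hSK h.mem)) hR
    linarith
  have hcoer : ∀ φ ψ χ, Feasible f S ν R φ ψ χ → ψ 0 = 0 →
      ‖φ‖ - B₀ ≤ dualValue f F ν φ ψ χ := by
    intro φ ψ χ h h0
    have h1 := hE φ ψ χ h
    have h2 := hA φ ψ χ h h0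
    have h3 := h.dual.integral_nonneg h0
    rw [dualValue]
    linarith
  set V : Set ℝ := {a | ∃ φ ψ χ, Feasible f S ν R φ ψ χ ∧ dualValue f F ν φ ψ χ = a} with hV
  have hVne : V.Nonempty := by
    obtain ⟨φ, hφS, hφ⟩ := hne
    -- Cauchy–Schwarz on the ball of radius `R` makes `R * ‖x‖` and `0` an admissible pair.
    refine ⟨_, φ, fun x => R * ‖x‖, fun _ => 0, ⟨hφS, hφ, ?_, integrable_const _, ?_⟩, rfl⟩
    · refine LipschitzWith.of_dist_le_mul fun x y => ?_
      rw [Real.coe_toNNReal _ hR, Real.dist_eq, ← mul_sub, abs_mul, abs_of_nonneg hR, dist_eq_norm]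
      exact mul_le_mul_of_nonneg_left (abs_norm_sub_norm_le x y) hR
    · filter_upwards [hνR] with y hy x
      have h1 := real_inner_le_norm x y
      have h2 := mul_le_mul_of_nonneg_left hy (norm_nonneg x)
      linarith
  have hVb : BddBelow V := by
    refine ⟨-B₀, ?_⟩
    rintro _ ⟨φ, ψ, χ, h, rfl⟩
    obtain ⟨h1, h2⟩ := h.normalize hmass hF
    rw [← h2]
    have := hcoer _ _ _ h1 (sub_self _)
    linarith [norm_nonneg φ]
  -- a normalized minimizing sequence
  obtain ⟨φ, ψ, χ, hfeas, h0, hlim⟩ : ∃ (φ : ℕ → K) (ψ χ : ℕ → Vec d → ℝ),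
      (∀ n, Feasible f S ν R (φ n : sobolevZero Ω q) (ψ n) (χ n)) ∧ (∀ n, ψ n 0 = 0) ∧
      Filter.Tendsto (fun n => dualValue f F ν (φ n : sobolevZero Ω q) (ψ n) (χ n)) Filter.atTop
        (𝓝 (sInf V)) := by
    obtain ⟨a, -, ha, haV⟩ := exists_seq_tendsto_sInf hVne hVb
    choose φ ψ χ h hval using haV
    refine ⟨fun n => ⟨φ n, hSK (h n).mem⟩, fun n x => ψ n x - ψ n 0, fun n y => χ n y + ψ n 0,
      fun n => ((h n).normalize hmass hF).1, fun n => sub_self _, ?_⟩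
    refine ha.congr fun n => ?_
    rw [← hval n]
    exact ((h n).normalize hmass hF).2.symm
  -- convergence of the fields in the finite dimensional span
  obtain ⟨φ, φ', ψ, χ, hfeas, h0, hlim, hφ⟩ : ∃ (φ : ℕ → K) (φ' : K) (ψ χ : ℕ → Vec d → ℝ),
      (∀ n, Feasible f S ν R (φ n : sobolevZero Ω q) (ψ n) (χ n)) ∧ (∀ n, ψ n 0 = 0) ∧
      Filter.Tendsto (fun n => dualValue f F ν (φ n : sobolevZero Ω q) (ψ n) (χ n)) Filter.atTop
        (𝓝 (sInf V)) ∧ Filter.Tendsto φ Filter.atTop (𝓝 φ') := by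
    obtain ⟨B, hB⟩ := hlim.bddAbove_range
    obtain ⟨φ', k, hk, hkφ⟩ := exists_subseq_tendsto_of_norm_le K (φ := φ) (B := B + B₀)
      fun n => by
        have h1 := hcoer _ _ _ (hfeas n) (h0 n)
        have h2 := hB (mem_range_self n)
        linarith
    exact ⟨φ ∘ k, φ', ψ ∘ k, χ ∘ k, fun n => hfeas _, fun n => h0 _,
      hlim.comp hk.tendsto_atTop, hkφ⟩
  -- almost everywhere convergence of the fields
  obtain ⟨φ, ψ, χ, hfeas, h0, hlim, hφ, hae⟩ : ∃ (φ : ℕ → K) (ψ χ : ℕ → Vec d → ℝ),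
      (∀ n, Feasible f S ν R (φ n : sobolevZero Ω q) (ψ n) (χ n)) ∧ (∀ n, ψ n 0 = 0) ∧
      Filter.Tendsto (fun n => dualValue f F ν (φ n : sobolevZero Ω q) (ψ n) (χ n)) Filter.atTop
        (𝓝 (sInf V)) ∧ Filter.Tendsto φ Filter.atTop (𝓝 φ') ∧
      ∀ᵐ x ∂volume.restrict Ω, Filter.Tendsto (fun n => fld (φ n : sobolevZero Ω q) x) Filter.atTop
        (𝓝 (fld (φ' : sobolevZero Ω q) x)) := by
    have h1 := tendsto_map_of_finiteDimensional K (fldL1 Ω q) hφ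
    obtain ⟨k, hk, hkae⟩ := (tendstoInMeasure_of_tendsto_Lp h1).exists_seq_tendsto_ae
    refine ⟨φ ∘ k, ψ ∘ k, χ ∘ k, fun n => hfeas _, fun n => h0 _, hlim.comp hk.tendsto_atTop,
      hφ.comp hk.tendsto_atTop, ?_⟩
    filter_upwards [hkae, coeFn_fldL1 (φ' : sobolevZero Ω q),
      ae_all_iff.2 fun n => coeFn_fldL1 (φ n : sobolevZero Ω q)] with x hx hx' hxn
    rw [← hx']
    exact hx.congr fun n => hxn (k n)
  -- pointwise convergence of the potentials
  obtain ⟨φ, ψ, χ, ψ', hfeas, h0, hlim, hφ, hae, hlip, hψ⟩ :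
      ∃ (φ : ℕ → K) (ψ χ : ℕ → Vec d → ℝ) (ψ' : Vec d → ℝ),
      (∀ n, Feasible f S ν R (φ n : sobolevZero Ω q) (ψ n) (χ n)) ∧ (∀ n, ψ n 0 = 0) ∧
      Filter.Tendsto (fun n => dualValue f F ν (φ n : sobolevZero Ω q) (ψ n) (χ n)) Filter.atTop
        (𝓝 (sInf V)) ∧ Filter.Tendsto φ Filter.atTop (𝓝 φ') ∧
      (∀ᵐ x ∂volume.restrict Ω, Filter.Tendsto (fun n => fld (φ n : sobolevZero Ω q) x)
        Filter.atTop (𝓝 (fld (φ' : sobolevZero Ω q) x))) ∧ LipschitzWith R.toNNReal ψ' ∧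
      ∀ x, Filter.Tendsto (fun n => ψ n x) Filter.atTop (𝓝 (ψ' x)) := by
    obtain ⟨k, hk, ψ', hlip, hψ⟩ :=
      exists_subseq_tendsto_of_lipschitz (fun n => (hfeas n).dual.lipschitz) h0
    exact ⟨φ ∘ k, ψ ∘ k, χ ∘ k, ψ', fun n => hfeas _, fun n => h0 _, hlim.comp hk.tendsto_atTop,
      hφ.comp hk.tendsto_atTop, hae.mono fun x hx => hx.comp hk.tendsto_atTop, hlip, hψ⟩
  have hAlim : Filter.Tendsto (fun n => ∫ x in Ω, ψ n (divg (φ n : sobolevZero Ω q) x + F x))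
      Filter.atTop (𝓝 (∫ x in Ω, ψ' (divg (φ' : sobolevZero Ω q) x + F x))) := by
    refine tendsto_integral_comp_of_lipschitz (fun n => (hfeas n).dual.lipschitz) h0 hψ
      (fun n => integrable_divg_add hF _) (integrable_divg_add hF _) ?_
    have h1 := tendsto_iff_norm_sub_tendsto_zero.1
      (tendsto_map_of_finiteDimensional K (divL1 Ω q) hφ)
    refine h1.congr fun n => ?_
    have h2 : ∫ x in Ω, ‖divg (φ n : sobolevZero Ω q) x + F x
        - (divg (φ' : sobolevZero Ω q) x + F x)‖ =
        ∫ x in Ω, ‖divg ((φ n : sobolevZero Ω q) - (φ' : sobolevZero Ω q)) x‖ := by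
      refine integral_congr_ae ?_
      filter_upwards [divg_sub (φ n : sobolevZero Ω q) φ'] with x hx
      rw [hx, add_sub_add_right_eq_sub]
    rw [h2, integral_norm_divg, map_sub]
  -- convergence of the energies
  obtain ⟨k, e, hk, he⟩ : ∃ (k : ℕ → ℕ) (e : ℝ), StrictMono k ∧ Filter.Tendsto (fun n =>
      ∫ x in Ω, legendreReal f (fld (φ (k n) : sobolevZero Ω q) x)) Filter.atTop (𝓝 e) := by
    obtain ⟨B, hB⟩ := hlim.bddAbove_range
    obtain ⟨B', hB'⟩ := hAlim.bddBelow_range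
    -- Above, the energy is the bounded total value minus a `ψ`-term bounded below and a nonnegative
    -- `χ`-term.
    have hmem : ∀ n, ∫ x in Ω, legendreReal f (fld (φ n : sobolevZero Ω q) x) ∈
        Icc (-∫ _ in Ω, C) (B - B') := fun n => by
      constructor
      · have h1 := hE _ _ _ (hfeas n)
        have h2 : 0 ≤ (R * Cd + 1) * ‖(φ n : sobolevZero Ω q)‖ := by positivity
        linarith
      · have h1 := hB (mem_range_self n)
        have h2 := hB' (mem_range_self n)
        have h3 := (hfeas n).dual.integral_nonneg (h0 n)
        simp only [dualValue] at h1 h2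
        linarith
    obtain ⟨e, -, k, hk, hke⟩ := isCompact_Icc.tendsto_subseq hmem
    exact ⟨k, e, hk, hke⟩
  have hX : Filter.Tendsto (fun n => ∫ y, χ (k n) y ∂ν) Filter.atTop
      (𝓝 (sInf V - e - ∫ x in Ω, ψ' (divg (φ' : sobolevZero Ω q) x + F x))) := by
    refine (((hlim.comp hk.tendsto_atTop).sub he).sub (hAlim.comp hk.tendsto_atTop)).congr
      fun n => ?_
    simp only [Function.comp, dualValue]
    ring
  obtain ⟨χ', hdual, hχ'⟩ := DualPair.exists_limit (fun n => (hfeas (k n)).dual)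
    (fun n => h0 (k n)) hlip (fun x => (hψ x).comp hk.tendsto_atTop) hX
  obtain ⟨hen, hele⟩ := HasFiniteEnergy.of_tendsto (fun n => (hfeas (k n)).energy)
    (Lp.aestronglyMeasurable (fld (φ' : sobolevZero Ω q))).aemeasurable
    (hae.mono fun x hx => hx.comp hk.tendsto_atTop) he
  have hmem : (φ' : sobolevZero Ω q) ∈ S :=
    hScl.mem_of_tendsto ((continuous_subtype_val.tendsto φ').comp hφ)
      (Filter.Eventually.of_forall fun n => (hfeas n).mem)
  refine ⟨φ', ψ', χ', ⟨hmem, hen, hdual⟩, fun φ₁ ψ₁ χ₁ h₁ => ?_⟩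
  have hm := csInf_le hVb ⟨φ₁, ψ₁, χ₁, h₁, rfl⟩
  refine le_trans ?_ hm
  rw [dualValue]
  linarith

end Minimization

/-! ### Non-degeneracy, displacement bounds and optimality of the field -/

section Final

variable {d : ℕ} {Ω Λ : Set (Vec d)} {q : ℝ} [Fact (1 < q)] {f : Mat d → ℝ}
  {F : Vec d → Vec d} {S : Set (sobolevZero Ω q)} {R : ℝ}

/-- Adding a map with countable range preserves non-degeneracy. -/
lemma NonDegenerate.add_countable {g : Vec d → Vec d} (hg : NonDegenerate Ω g)
    (hF : (F '' Ω).Countable) : NonDegenerate Ω fun x => g x + F x := by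
  intro N hN
  -- Split `Ω` by the value `c` of `F`: on each piece `g` lands in the translate of `N` by `-c`,
  -- still a null set.
  have hsub : Ω ∩ (fun x => g x + F x) ⁻¹' N ⊆
      ⋃ c ∈ F '' Ω, Ω ∩ g ⁻¹' ((fun y => y + c) ⁻¹' N) := by
    rintro x ⟨hx, hxN⟩
    exact mem_biUnion (mem_image_of_mem F hx) ⟨hx, hxN⟩
  refine measure_mono_null hsub ((measure_biUnion_null_iff hF).2 fun c _ => hg _ ?_)
  rw [measure_preimage_add_right, hN]

lemma NonDegenerate.ae_notMem {g : Vec d → Vec d} (hΩ : MeasurableSet Ω)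
    (hg : NonDegenerate Ω g) {N : Set (Vec d)} (hN : volume N = 0) :
    ∀ᵐ x ∂volume.restrict Ω, g x ∉ N := by
  rw [ae_restrict_iff' hΩ, ae_iff]
  refine measure_mono_null (fun x hx => ?_) (hg N hN)
  simpa using hx

variable [IsFiniteMeasure (volume.restrict Ω)]

/-- On a finite dimensional space of fields, every bounded measurable map satisfies the
continuity estimate required of displacements. -/
lemma exists_displacement_bound (hΩ : IsOpen Ω) [FiniteDimensional ℝ (Submodule.span ℝ S)]
    (hR : 0 ≤ R) {u : Vec d → Vec d}
    (huR : ∀ᵐ x ∂volume.restrict Ω, ‖u x‖ ≤ R) :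
    ∃ c : ℝ, 0 < c ∧ ∀ φ ∈ S, |∫ x in Ω, inner ℝ (u x) (divg φ x)| ≤ c * ‖fld φ‖ := by
  obtain ⟨C, hC0, hC⟩ := exists_norm_map_le_of_finiteDimensional (Submodule.span ℝ S) (divL1 Ω q)
  obtain ⟨C', hC0', hC'⟩ := exists_norm_le_map_of_injective (Submodule.span ℝ S)
    (fldMap_injective (q := q) hΩ)
  refine ⟨R * (C * C') + 1, by positivity, fun φ hφ => ?_⟩
  have hφ' : φ ∈ Submodule.span ℝ S := Submodule.subset_span hφ
  calc |∫ x in Ω, inner ℝ (u x) (divg φ x)| ≤ ∫ x in Ω, R * ‖divg φ x‖ := by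
        rw [← Real.norm_eq_abs]
        refine norm_integral_le_of_norm_le ((integrable_divg φ).norm.const_mul R) ?_
        filter_upwards [huR] with x hx
        exact (norm_inner_le_norm _ _).trans (mul_le_mul_of_nonneg_right hx (norm_nonneg _))
    _ = R * ‖divL1 Ω q φ‖ := by rw [integral_const_mul, integral_norm_divg]
    _ ≤ R * (C * (C' * ‖fldMap Ω q φ‖)) := by
        have h1 := hC φ hφ'
        have h2 := hC' φ hφ'
        have h3 := mul_le_mul_of_nonneg_left h2 hC0
        exact mul_le_mul_of_nonneg_left (h1.trans h3) hR
    _ = R * (C * C') * ‖fld φ‖ := by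
        change R * (C * (C' * ‖fld φ‖)) = _
        ring
    _ ≤ _ := by
        have := norm_nonneg (fld φ)
        linarith

/-- First order optimality of the field in the joint dual problem. -/
lemma energy_le_of_dual_minimizer {ν : Measure (Vec d)} (hF : IntegrableOn F Ω)
    (hS : Convex ℝ S) {φ₀ φ : sobolevZero Ω q} {ψ χ : Vec d → ℝ}
    (h₀ : Feasible f S ν R φ₀ ψ χ)
    (hmin : ∀ φ, Feasible f S ν R φ ψ χ → dualValue f F ν φ₀ ψ χ ≤ dualValue f F ν φ ψ χ)
    (hdiff : ∀ᵐ x ∂volume.restrict Ω, DifferentiableAt ℝ ψ (divg φ₀ x + F x))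
    (hφ : φ ∈ S) (hφe : HasFiniteEnergy f (volume.restrict Ω) (fld φ)) :
    (∫ x in Ω, legendreReal f (fld φ₀ x)) - (∫ x in Ω, legendreReal f (fld φ x)) ≤
      ∫ x in Ω, inner ℝ (gradient ψ (divg φ₀ x + F x)) (divg φ x - divg φ₀ x) := by
  refine ge_of_tendsto (tendsto_integral_lipschitz_diff_quotient h₀.dual.lipschitz
    (integrable_divg_add hF φ₀) ((integrable_divg φ).sub (integrable_divg φ₀)) hdiff) ?_
  filter_upwards [self_mem_nhdsWithin, Ioc_mem_nhdsGT (zero_lt_one (α := ℝ))] with t _ ht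
  obtain ⟨ht0, ht1⟩ := ht
  -- Along the segment the potentials are kept fixed. Convexity bounds the energy increase by `t`
  -- times the difference of the energies, so minimality, divided by `t`, bounds the difference
  -- quotient of the `ψ`-term from below.
  set φt := (1 - t) • φ₀ + t • φ with hφt
  have hmem : φt ∈ S := hS h₀.mem hφ (by linarith) ht0.le (by ring)
  have hfld : ∀ᵐ x ∂volume.restrict Ω, fld φt x = (1 - t) • fld φ₀ x + t • fld φ x := by
    filter_upwards [coeFn_fldL1 φt, coeFn_fldL1 φ₀, coeFn_fldL1 φ,
      Lp.coeFn_add ((1 - t) • fldL1 Ω q φ₀) (t • fldL1 Ω q φ),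
      Lp.coeFn_smul (1 - t) (fldL1 Ω q φ₀), Lp.coeFn_smul t (fldL1 Ω q φ)]
      with x h1 h2 h3 h4 h5 h6
    rw [← h1, hφt, map_add, map_smul, map_smul, h4, Pi.add_apply, h5, h6, Pi.smul_apply,
      Pi.smul_apply, h2, h3]
  obtain ⟨he, hele⟩ := h₀.energy.convex_comb hφe
    (Lp.aestronglyMeasurable (fld φt)).aemeasurable ht0.le ht1 hfld
  have hψ : ∫ x in Ω, ψ (divg φt x + F x) =
      ∫ x in Ω, ψ (divg φ₀ x + F x + t • (divg φ x - divg φ₀ x)) := by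
    refine integral_congr_ae ?_
    filter_upwards [divg_add ((1 - t) • φ₀) (t • φ), divg_smul (1 - t) φ₀, divg_smul t φ]
      with x h1 h2 h3
    rw [hφt, h1, h2, h3]
    congr 1
    module
  have h1 := hmin φt ⟨hmem, he, h₀.dual⟩
  rw [dualValue, dualValue, hψ] at h1
  rw [le_div_iff₀ ht0]
  linarith

end Final

/-! ### The pseudo-energy as a supremum over fields, and the saddle point -/

section SaddlePoint

variable {d : ℕ} {Ω : Set (Vec d)} {q : ℝ} [Fact (1 < q)] {f : Mat d → ℝ}
  {S : Set (sobolevZero Ω q)} [IsFiniteMeasure (volume.restrict Ω)]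

omit [IsFiniteMeasure (volume.restrict Ω)] in
lemma le_pseudoEnergy {φ₀ : sobolevZero Ω q} (hφ₀ : φ₀ ∈ S)
    (he : HasFiniteEnergy f (volume.restrict Ω) (fld φ₀)) (u : Vec d → Vec d) :
    ((-(∫ x in Ω, inner ℝ (u x) (divg φ₀ x)) - ∫ x in Ω, legendreReal f (fld φ₀ x) : ℝ) : EReal)
      ≤ pseudoEnergy f S u := by
  rw [EReal.coe_sub, ← he.extIntegral_eq]
  exact le_iSup₂ (f := fun φ (_ : φ ∈ S) =>
    (((-∫ x in Ω, inner ℝ (u x) (divg φ x) : ℝ) : EReal)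
      - extIntegral Ω (fun x => legendre f (fld φ x)))) φ₀ hφ₀

/-- Fields of infinite energy contribute `⊥` to the supremum, so only those of finite energy matter.
-/
lemma pseudoEnergy_le {u : Vec d → Vec d} {a : ℝ}
    (h : ∀ φ ∈ S, HasFiniteEnergy f (volume.restrict Ω) (fld φ) →
      -(∫ x in Ω, inner ℝ (u x) (divg φ x)) - (∫ x in Ω, legendreReal f (fld φ x)) ≤ a) :
    pseudoEnergy f S u ≤ (a : EReal) := by
  refine iSup₂_le fun φ hφ => ?_
  by_cases ht : extIntegral Ω (fun x => legendre f (fld φ x)) = ⊤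
  · rw [ht, EReal.sub_top]
    exact bot_le
  · have he := hasFiniteEnergy_of_extIntegral_ne_top (f := f)
      (Lp.aestronglyMeasurable (fld φ)).aemeasurable ht
    rw [he.extIntegral_eq, ← EReal.coe_sub, EReal.coe_le_coe_iff]
    exact h φ hφ he

end SaddlePoint

set_option maxHeartbeats 1000000 in
/-- Under condition `(ND)_S`, the minimization problem over incompressible displacements has a
unique solution: the composition of `div φ₀ + F` with the gradient of an optimal convex potential,
where `φ₀` is a minimizer of the dual problem. -/
theorem exists_unique_isMinimizer {d : ℕ} {p q r : ℝ} [Fact (1 < q)] (hp : 0 < p)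
    {Ω Λ : Set (Vec d)} (hΩo : IsOpen Ω) (hΩb : Bornology.IsBounded Ω) (hr : 0 < r)
    (hrΛ : Metric.ball 0 (1 / r) ⊆ Λ) (hΛr : Λ ⊆ Metric.ball 0 (r / 2))
    (hvol : volume Ω = volume Λ)
    {f : Mat d → ℝ} {S : Set (sobolevZero Ω q)} (hf : AdmissibleIntegrand p f S)
    {F : Vec d → Vec d} (hFint : IntegrableOn F Ω volume)
    [FiniteDimensional ℝ (Submodule.span ℝ S)] (hScl : IsClosed S) (hScv : Convex ℝ S)
    (hND : ConditionND F S) :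
    ∃ u₀ : Vec d → Vec d, IsMinimizer Λ f F S u₀ ∧
      ∀ u, IsMinimizer Λ f F S u → u =ᵐ[volume.restrict Ω] u₀ := by
  have hμ : IsFiniteMeasure (volume.restrict Ω) := ⟨by
    rw [Measure.restrict_apply_univ]
    exact hΩb.measure_lt_top⟩
  have hν : IsFiniteMeasure (volume.restrict Λ) := ⟨by
    rw [Measure.restrict_apply_univ]
    exact (Metric.isBounded_ball.subset hΛr).measure_lt_top⟩
  have hmass : (volume.restrict Ω) univ = (volume.restrict Λ) univ := by
    rw [Measure.restrict_apply_univ, Measure.restrict_apply_univ, hvol]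
  have hν0 : volume.restrict Λ ≠ 0 := by
    rw [Ne, Measure.restrict_eq_zero]
    exact ((Metric.measure_ball_pos volume _ (by positivity)).trans_le (measure_mono hrΛ)).ne'
  have hR : 0 ≤ r / 2 := by linarith
  have hνR : ∀ᵐ y ∂volume.restrict Λ, ‖y‖ ≤ r / 2 := by
    refine ae_restrict_of_ae_restrict_of_subset hΛr ?_
    refine ae_restrict_of_forall_mem measurableSet_ball fun y hy => ?_
    exact (mem_ball_zero_iff.1 hy).le
  have hνcl : ∀ᵐ y ∂volume.restrict Λ, y ∈ closure Λ :=
    ae_restrict_of_ae_restrict_of_subset subset_closure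
      (ae_restrict_mem isClosed_closure.measurableSet)
  have hfb : ∀ M : ℝ, ∃ C, ∀ ξ, ‖ξ‖ ≤ M → f ξ ≤ C := by
    obtain ⟨a, b, c, -, -, hc, hgr, -⟩ := hf.growth
    refine fun M => ⟨c * (M ^ p / p) + b, fun ξ hξ => ((hgr ξ).1).trans ?_⟩
    gcongr
  have hne : ∃ φ ∈ S, HasFiniteEnergy f (volume.restrict Ω) (fld φ) := by
    obtain ⟨φ, hφS, hφ, -⟩ := hf.nonempty
    exact ⟨φ, hφS, hasFiniteEnergy_of_extIntegral_ne_top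
      (Lp.aestronglyMeasurable (fld φ)).aemeasurable hφ⟩
  obtain ⟨φ₀, ψ₁, χ, hfeas, hmin⟩ := exists_feasible_minimizer (F := F) hΩo hmass hFint hR
    hνR hfb hScl hne
  obtain ⟨ψ, hψ, hψeq, hdiff, hmeas, hmap, hopt⟩ := exists_unique_optimal_map hν0 hνR
    (integrable_divg_add hFint φ₀)
    (fun N hN => (hND φ₀ hfeas.mem).ae_notMem hΩo.measurableSet hN) hfeas.dual
    (fun ψ' χ' h => by
      have := hmin φ₀ ψ' χ' ⟨hfeas.mem, hfeas.energy, h⟩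
      rw [dualValue, dualValue] at this
      linarith)
  have hfeas' : Feasible f S (volume.restrict Λ) (r / 2) φ₀ ψ χ :=
    ⟨hfeas.mem, hfeas.energy, hψ⟩
  have hval : dualValue f F (volume.restrict Λ) φ₀ ψ χ =
      dualValue f F (volume.restrict Λ) φ₀ ψ₁ χ := by
    rw [dualValue, dualValue, hψeq]
  have hfoc := fun φ => energy_le_of_dual_minimizer (φ := φ) hFint hScv hfeas'
    (fun φ h => hval.trans_le (hmin φ ψ χ h)) hdiff
  set u₀ : Vec d → Vec d :=
    fun x => gradient ψ (divg φ₀ x + F x) with hu₀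
  have hbound : ∀ u : Vec d → Vec d, AEMeasurable u (volume.restrict Ω) →
      (volume.restrict Ω).map u = volume.restrict Λ → ∀ᵐ x ∂volume.restrict Ω, ‖u x‖ ≤ r / 2 := by
    intro u hu hmu
    rw [← hmu] at hνR
    exact ae_of_ae_map hu hνR
  have hmap_of : ∀ u ∈ incompressible Λ S,
      AEMeasurable u (volume.restrict Ω) ∧ (volume.restrict Ω).map u = volume.restrict Λ :=
    fun u hu => ⟨hu.1.1, map_eq_of_integral_eq hu.1.1 hu.2⟩
  have hu₀mem : u₀ ∈ incompressible Λ S := by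
    refine ⟨⟨hmeas, ?_, exists_displacement_bound hΩo hR (hbound u₀ hmeas hmap)⟩,
      fun l hl _ => ?_⟩
    · rw [← hmap] at hνcl
      exact ae_of_ae_map hmeas hνcl
    · rw [← hmap, integral_map hmeas hl.aestronglyMeasurable]
  have hsplit : ∀ u : Vec d → Vec d, AEMeasurable u (volume.restrict Ω) →
      (volume.restrict Ω).map u = volume.restrict Λ →
      ∫ x in Ω, inner ℝ (u x) (divg φ₀ x + F x) =
        (∫ x in Ω, inner ℝ (u x) (divg φ₀ x)) + ∫ x in Ω, inner ℝ (F x) (u x) := by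
    intro u hu hmu
    have hb := hbound u hu hmu
    simp only [inner_add_right, real_inner_comm (u _) (F _)]
    exact integral_add (integrable_inner_of_norm_le hu hb (integrable_divg φ₀))
      (integrable_inner_of_norm_le hu hb hFint)
  set e₀ := ∫ x in Ω, legendreReal f (fld φ₀ x) with he₀
  -- Weak duality: `φ₀` is one competitor in the supremum defining the pseudo-energy.
  have hlow : ∀ u : Vec d → Vec d, AEMeasurable u (volume.restrict Ω) →
      (volume.restrict Ω).map u = volume.restrict Λ →
      ((-(∫ x in Ω, inner ℝ (u x) (divg φ₀ x + F x)) - e₀ : ℝ) : EReal) ≤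
        energy f F S u := by
    intro u hu hmu
    refine le_trans (le_of_eq ?_)
      (EReal.sub_le_sub (le_pseudoEnergy hfeas.mem hfeas.energy u) le_rfl)
    rw [← EReal.coe_sub, hsplit u hu hmu]
    congr 1
    ring
  -- The first order condition says that for `u₀` no field does better than `φ₀`, so weak duality is
  -- an equality there.
  have hup : energy f F S u₀ ≤
      ((-(∫ x in Ω, inner ℝ (u₀ x) (divg φ₀ x + F x)) - e₀ : ℝ) : EReal) := by
    have hb := hbound u₀ hmeas hmap
    have h1 : pseudoEnergy f S u₀ ≤
        ((-(∫ x in Ω, inner ℝ (u₀ x) (divg φ₀ x)) - e₀ : ℝ) : EReal) := by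
      refine pseudoEnergy_le fun φ hφ hφe => ?_
      have h2 := hfoc φ hφ hφe
      simp only [inner_sub_right] at h2
      rw [integral_sub
        (integrable_inner_of_norm_le hmeas hb (integrable_divg φ))
        (integrable_inner_of_norm_le hmeas hb (integrable_divg φ₀))] at h2
      linarith
    refine (EReal.sub_le_sub h1 le_rfl).trans (le_of_eq ?_)
    rw [← EReal.coe_sub, hsplit u₀ hmeas hmap]
    congr 1
    ring
  refine ⟨u₀, ⟨hu₀mem, fun v hv => ?_⟩, fun u hu => ?_⟩
  · obtain ⟨hvm, hvmap⟩ := hmap_of v hv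
    refine hup.trans (le_trans ?_ (hlow v hvm hvmap))
    rw [EReal.coe_le_coe_iff]
    linarith [(hopt v hvm hvmap).1]
  · obtain ⟨hum, humap⟩ := hmap_of u hu.1
    refine (hopt u hum humap).2 ?_
    -- A second minimizer satisfies the reverse transport inequality, so the equality case
    -- identifies it with `u₀`.
    have h1 := (hlow u hum humap).trans ((hu.2 u₀ hu₀mem).trans hup)
    rw [EReal.coe_le_coe_iff] at h1
    linarith

end PolyMin

end

theorem corollary4p4 {d : ℕ} (p q r : ℝ) [Fact (1 < q)] (hpq : p.HolderConjugate q)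
    (Ω Λ : Set (PolyMin.Vec d))
    (hΩo : IsOpen Ω) (hΩc : Convex ℝ Ω) (hΩb : Bornology.IsBounded Ω)
    (hΛc : Convex ℝ Λ) (hr : 1 < r)
    (hrΛ : Metric.ball 0 (1 / r) ⊆ Λ) (hΛr : Λ ⊆ Metric.ball 0 (r / 2))
    (hvol : volume Ω = volume Λ)
    (hbd : PolyMin.SmoothExtremeBoundary Ω)
    (f : PolyMin.Mat d → ℝ) (S : Set (PolyMin.sobolevZero Ω q))
    (hf : PolyMin.AdmissibleIntegrand p f S)
    (F : PolyMin.Vec d → PolyMin.Vec d) (hFint : IntegrableOn F Ω volume)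
    (hSfin : FiniteDimensional ℝ (Submodule.span ℝ S)) (hSne : S.Nonempty)
    (hScl : IsClosed S) (hScv : Convex ℝ S)
    (hSnd : ∀ φ ∈ S, PolyMin.NonDegenerate Ω (PolyMin.divg φ))
    (hF : (F '' Ω).Countable) :
    PolyMin.ConditionND F S ∧
      ∃ u₀ : PolyMin.Vec d → PolyMin.Vec d, PolyMin.IsMinimizer Λ f F S u₀ ∧
        ∀ u, PolyMin.IsMinimizer Λ f F S u → u =ᵐ[volume.restrict Ω] u₀ := by
  have hND : PolyMin.ConditionND F S := fun φ hφ => (hSnd φ hφ).add_countable hF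
  exact ⟨hND, PolyMin.exists_unique_isMinimizer hpq.pos hΩo hΩb (by linarith) hrΛ hΛr hvol hf hFint
    hScl hScv hND⟩
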